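/- Let $(M,J,g)$ be an almost Norden manifold: $M$ is a smooth (finite-dimensional, Hausdorff, $\sigma$-compact, boundaryless) manifold, $J$ is a smooth almost complex structure on $M$ ($J^2=-\mathrm{id}$), and $g$ is a smooth pseudo-Riemannian metric with $g(JX,JY)=-g(X,Y)$ for all $X,Y$ (so that $g$ has neutral signature). Let $\nabla$ be the Levi-Civita connection of $g$ and $R(X,Y)Z=\nabla_X\nabla_YZ-\nabla_Y\nabla_XZ-\nabla_{[X,Y]}Z$ its curvature. For $u\in T_pM$ and $X\in T_pM$ let $X^V\in T_u(TM)$ be the vertical lift of $X$ (the derivative at $t=0$ of $t\mapsto u+tX$) and let $X^H\in T_u(TM)$ be the horizontal lift of $X$ with respect to $\nabla$ ($X^H=dY_p(X)-(\nabla_XY)^V$ for any local vector field $Y$ with $Y(p)=u$). Let $H=(J_1,J_2,J_3)$ be the almost hypercomplex structure on the tangent bundle $TM$ determined by $$J_1X^H=-(JX)^H,\quad J_1X^V=(JX)^V,\qquad J_2X^H=X^V,\quad J_2X^V=-X^H,\qquad J_3X^H=(JX)^V,\quad J_3X^V=(JX)^H.$$ The manifold $(TM,J_\alpha)$ is called complex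 if the Nijenhuis tensor $$N_\alpha(\hat X,\hat Y)=[\hat X,\hat Y]+J_\alpha[J_\alpha\hat X,\hat Y]+J_\alpha[\hat X,J_\alpha\hat Y]-[J_\alpha\hat X,J_\alpha\hat Y]$$ vanishes identically, and $(TM,H)$ is called hypercomplex if $N_1=N_2=N_3=0$. $M$ is called flat if $R=0$, and $J$ is called parallel if $\nabla J=0$. Then: 1. $(TM,J_1)$ is complex if and only if $(TM,J_3)$ is complex, and each of these holds if and only if $M$ is flat and $J$ is parallel; 2. $(TM,J_2)$ is complex if and only if $M$ is flat; 3. $(TM,H)$ is hypercomplex if and only if $M$ is flat and $J$ is parallel. -/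

import Mathlib

open Bundle VectorField
open scoped Manifold ContDiff

noncomputable section

/-! ### Tensor fields on a manifold -/

section General

variable {E : Type*} [NormedAddCommGroup E] [NormedSpace ℝ E]
  {H : Type*} [TopologicalSpace H] (I : ModelWithCorners ℝ E H)
  {N : Type*} [TopologicalSpace N] [ChartedSpace H N]

/-- The vector field `X` on `N` is smooth at the point `x`. -/
def SmoothFieldAt [IsManifold I 1 N] (X : Π x : N, TangentSpace I x) (x : N) : Prop :=
  ContMDiffAt I I.tangent ∞ (fun y ↦ (⟨y, X y⟩ : TangentBundle I N)) x

/-- The expression `[X, Y] + A[AX, Y] + A[X, AY] - [AX, AY]`, the Nijenhuis tensor of the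
endomorphism field `A` evaluated on the vector fields `X`, `Y`. -/
def nijenhuis (A : Π x : N, TangentSpace I x →ₗ[ℝ] TangentSpace I x)
    (X Y : Π x : N, TangentSpace I x) (x : N) : TangentSpace I x :=
  mlieBracket I X Y x
    + A x (mlieBracket I (fun y ↦ A y (X y)) Y x)
    + A x (mlieBracket I X (fun y ↦ A y (Y y)) x)
    - mlieBracket I (fun y ↦ A y (X y)) (fun y ↦ A y (Y y)) x

/-- The almost complex structure `A` is complex (integrable): its Nijenhuis tensor vanishes at every
point, on all vector fields which are smooth there. -/
def IsComplexStructure [IsManifold I 1 N]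
    (A : Π x : N, TangentSpace I x →ₗ[ℝ] TangentSpace I x) : Prop :=
  ∀ (x : N) (X Y : Π x : N, TangentSpace I x),
    SmoothFieldAt I X x → SmoothFieldAt I Y x → nijenhuis I A X Y x = 0

/-- The almost hypercomplex structure `(A₁, A₂, A₃)` is hypercomplex: all three Nijenhuis tensors
vanish. -/
def IsHypercomplexStructure [IsManifold I 1 N]
    (A₁ A₂ A₃ : Π x : N, TangentSpace I x →ₗ[ℝ] TangentSpace I x) : Prop :=
  IsComplexStructure I A₁ ∧ IsComplexStructure I A₂ ∧ IsComplexStructure I A₃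

end General

/-! ### Almost Norden manifolds and their Levi-Civita connection -/

section Base

variable {E : Type*} [NormedAddCommGroup E] [NormedSpace ℝ E]
  {M : Type*} [TopologicalSpace M] [ChartedSpace E M] [IsManifold 𝓘(ℝ, E) ∞ M]

/-- `J` is an almost complex structure on `M`: a smooth field of endomorphisms with `J² = -1`. -/
structure IsAlmostComplex
    (J : Π x : M, TangentSpace 𝓘(ℝ, E) x →L[ℝ] TangentSpace 𝓘(ℝ, E) x) : Prop where
  smooth : ContMDiff 𝓘(ℝ, E) (𝓘(ℝ, E).prod 𝓘(ℝ, E →L[ℝ] E)) ∞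
    (fun x ↦ TotalSpace.mk' (E →L[ℝ] E)
      (E := fun x : M ↦ TangentSpace 𝓘(ℝ, E) x →L[ℝ] TangentSpace 𝓘(ℝ, E) x) x (J x))
  sq : ∀ (x : M) (v : TangentSpace 𝓘(ℝ, E) x), J x (J x v) = -v

/-- `g` is a Norden metric on the almost complex manifold `(M, J)`: a smooth pseudo-Riemannian
metric with `g(J·, J·) = -g(·, ·)`. (The signature is then necessarily neutral.) -/
structure IsNordenMetric
    (J : Π x : M, TangentSpace 𝓘(ℝ, E) x →L[ℝ] TangentSpace 𝓘(ℝ, E) x)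
    (g : Π x : M, TangentSpace 𝓘(ℝ, E) x →L[ℝ] TangentSpace 𝓘(ℝ, E) x →L[ℝ] ℝ) : Prop where
  smooth : ContMDiff 𝓘(ℝ, E) (𝓘(ℝ, E).prod 𝓘(ℝ, E →L[ℝ] E →L[ℝ] ℝ)) ∞
    (fun x ↦ TotalSpace.mk' (E →L[ℝ] E →L[ℝ] ℝ)
      (E := fun x : M ↦ TangentSpace 𝓘(ℝ, E) x →L[ℝ] TangentSpace 𝓘(ℝ, E) x →L[ℝ] ℝ) x (g x))
  symm : ∀ (x : M) (v w : TangentSpace 𝓘(ℝ, E) x), g x v w = g x w v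
  nondegenerate : ∀ (x : M) (v : TangentSpace 𝓘(ℝ, E) x), (∀ w, g x v w = 0) → v = 0
  norden : ∀ (x : M) (v w : TangentSpace 𝓘(ℝ, E) x), g x (J x v) (J x w) = -g x v w

/-- `cov` is the Levi-Civita connection of `g`: smooth, torsion-free, and
`X g(Y, Z) = g(∇_X Y, Z) + g(Y, ∇_X Z)`. (Here `cov Y x v` is `∇_v Y` at the point `x`.) -/
structure IsLeviCivita [FiniteDimensional ℝ E]
    (g : Π x : M, TangentSpace 𝓘(ℝ, E) x →L[ℝ] TangentSpace 𝓘(ℝ, E) x →L[ℝ] ℝ)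
    (cov : CovariantDerivative 𝓘(ℝ, E) E (TangentSpace 𝓘(ℝ, E) : M → Type _)) : Prop where
  smooth : cov.ContMDiffCovariantDerivative ∞
  torsion_free : cov.torsion = 0
  metric : ∀ (x : M) (v : TangentSpace 𝓘(ℝ, E) x) (Y Z : Π x : M, TangentSpace 𝓘(ℝ, E) x),
    SmoothFieldAt 𝓘(ℝ, E) Y x → SmoothFieldAt 𝓘(ℝ, E) Z x →
      mvfderiv 𝓘(ℝ, E) (fun y ↦ g y (Y y) (Z y)) x v
        = g x (cov Y x v) (Z x) + g x (Y x) (cov Z x v)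

/-- The curvature `R(X, Y)Z = ∇_X ∇_Y Z - ∇_Y ∇_X Z - ∇_{[X, Y]} Z`. -/
def curvature (cov : CovariantDerivative 𝓘(ℝ, E) E (TangentSpace 𝓘(ℝ, E) : M → Type _))
    (X Y Z : Π x : M, TangentSpace 𝓘(ℝ, E) x) (x : M) : TangentSpace 𝓘(ℝ, E) x :=
  cov (fun y ↦ cov Z y (Y y)) x (X x) - cov (fun y ↦ cov Z y (X y)) x (Y x)
    - cov Z x (mlieBracket 𝓘(ℝ, E) X Y x)

/-- `M` is flat: the curvature tensor vanishes at every point. -/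
def IsFlat (cov : CovariantDerivative 𝓘(ℝ, E) E (TangentSpace 𝓘(ℝ, E) : M → Type _)) : Prop :=
  ∀ (x : M) (X Y Z : Π x : M, TangentSpace 𝓘(ℝ, E) x),
    SmoothFieldAt 𝓘(ℝ, E) X x → SmoothFieldAt 𝓘(ℝ, E) Y x → SmoothFieldAt 𝓘(ℝ, E) Z x →
      curvature cov X Y Z x = 0

/-- `J` is parallel: `(∇_v J) Y = ∇_v (J Y) - J ∇_v Y` vanishes for all `v` and `Y`. -/
def IsParallel (cov : CovariantDerivative 𝓘(ℝ, E) E (TangentSpace 𝓘(ℝ, E) : M → Type _))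
    (J : Π x : M, TangentSpace 𝓘(ℝ, E) x →L[ℝ] TangentSpace 𝓘(ℝ, E) x) : Prop :=
  ∀ (x : M) (v : TangentSpace 𝓘(ℝ, E) x) (Y : Π x : M, TangentSpace 𝓘(ℝ, E) x),
    SmoothFieldAt 𝓘(ℝ, E) Y x → cov (fun y ↦ J y (Y y)) x v - J x (cov Y x v) = 0

end Base

/-! ### Horizontal and vertical lifts, and the three structures on the tangent bundle -/

section Lifts

variable {E : Type*} [NormedAddCommGroup E] [NormedSpace ℝ E]
  {M : Type*} [TopologicalSpace M] [ChartedSpace E M] [IsManifold 𝓘(ℝ, E) ∞ M]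

/-- The vertical lift `X ↦ X^V` at `u ∈ T_p M`: the differential at `u` of the inclusion
`T_p M → TM` of the fibre. -/
def verticalLift (u : TangentBundle 𝓘(ℝ, E) M) :
    TangentSpace 𝓘(ℝ, E) u.proj →L[ℝ] TangentSpace 𝓘(ℝ, E).tangent u :=
  mfderiv 𝓘(ℝ, E) 𝓘(ℝ, E).tangent
    (fun v : E ↦ (⟨u.proj, v⟩ : TangentBundle 𝓘(ℝ, E) M)) (u.2 : E)

/-- The horizontal lift `X ↦ X^H` at `u ∈ T_p M` with respect to the connection `cov`:
`X^H = dY(X) - (∇_X Y)^V`, where `Y` is a local vector field with `Y(p) = u`. (The result does not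
depend on `Y`.) -/
def horizontalLift (cov : CovariantDerivative 𝓘(ℝ, E) E (TangentSpace 𝓘(ℝ, E) : M → Type _))
    (u : TangentBundle 𝓘(ℝ, E) M) :
    TangentSpace 𝓘(ℝ, E) u.proj →L[ℝ] TangentSpace 𝓘(ℝ, E).tangent u :=
  let Y : Π x : M, TangentSpace 𝓘(ℝ, E) x := FiberBundle.extend E u.2
  let dY : TangentSpace 𝓘(ℝ, E) u.proj →L[ℝ] TangentSpace 𝓘(ℝ, E).tangent u :=
    mfderiv 𝓘(ℝ, E) 𝓘(ℝ, E).tangent (fun x ↦ (⟨x, Y x⟩ : TangentBundle 𝓘(ℝ, E) M)) u.proj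
  dY - (verticalLift u).comp (cov Y u.proj)


theorem trivializationAt_fibre (p : M) (v : E) :
    (trivializationAt E (TangentSpace 𝓘(ℝ, E)) p (⟨p, v⟩ : TangentBundle 𝓘(ℝ, E) M)).2 = v :=
  tangentCoordChange_self (I := 𝓘(ℝ, E)) (mem_extChartAt_source (I := 𝓘(ℝ, E)) p)

theorem mdifferentiableAt_fibreInclusion (p : M) (v : E) :
    MDifferentiableAt 𝓘(ℝ, E) 𝓘(ℝ, E).tangent
      (fun v : E ↦ (⟨p, v⟩ : TangentBundle 𝓘(ℝ, E) M)) v := by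
  rw [mdifferentiableAt_totalSpace]
  refine ⟨mdifferentiableAt_const, ?_⟩
  simp only [trivializationAt_fibre]
  exact mdifferentiableAt_id

theorem mfderiv_proj_verticalLift (u : TangentBundle 𝓘(ℝ, E) M)
    (X : TangentSpace 𝓘(ℝ, E) u.proj) :
    mfderiv 𝓘(ℝ, E).tangent 𝓘(ℝ, E)
      (TotalSpace.proj : TangentBundle 𝓘(ℝ, E) M → M) u (verticalLift u X) = 0 := by
  have h : ∀ (p : M) (v X : E),
      mfderiv 𝓘(ℝ, E).tangent 𝓘(ℝ, E) (TotalSpace.proj : TangentBundle 𝓘(ℝ, E) M → M) ⟨p, v⟩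
        (mfderiv 𝓘(ℝ, E) 𝓘(ℝ, E).tangent
          (fun v : E ↦ (⟨p, v⟩ : TangentBundle 𝓘(ℝ, E) M)) v X) = 0 := by
    intro p v X
    have h := mfderiv_comp_apply (I := 𝓘(ℝ, E)) (I' := 𝓘(ℝ, E).tangent) (I'' := 𝓘(ℝ, E))
      (f := fun v : E ↦ (⟨p, v⟩ : TangentBundle 𝓘(ℝ, E) M))
      (g := (TotalSpace.proj : TangentBundle 𝓘(ℝ, E) M → M)) v
      (mdifferentiableAt_proj _) (mdifferentiableAt_fibreInclusion p v) X
    refine h.symm.trans ?_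
    have hc : (TotalSpace.proj : TangentBundle 𝓘(ℝ, E) M → M) ∘
        (fun v : E ↦ (⟨p, v⟩ : TangentBundle 𝓘(ℝ, E) M)) = fun _ ↦ p := rfl
    rw [hc, mfderiv_const]
    rfl
  exact h u.proj u.2 X

theorem mfderiv_proj_horizontalLift [FiniteDimensional ℝ E]
    (cov : CovariantDerivative 𝓘(ℝ, E) E (TangentSpace 𝓘(ℝ, E) : M → Type _))
    (u : TangentBundle 𝓘(ℝ, E) M) (X : TangentSpace 𝓘(ℝ, E) u.proj) :
    mfderiv 𝓘(ℝ, E).tangent 𝓘(ℝ, E)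
      (TotalSpace.proj : TangentBundle 𝓘(ℝ, E) M → M) u (horizontalLift cov u X) = X := by
  have h := mfderiv_comp_apply (I := 𝓘(ℝ, E)) (I' := 𝓘(ℝ, E).tangent) (I'' := 𝓘(ℝ, E))
    (f := fun x : M ↦ (⟨x, FiberBundle.extend E u.2 x⟩ : TangentBundle 𝓘(ℝ, E) M))
    (g := (TotalSpace.proj : TangentBundle 𝓘(ℝ, E) M → M)) u.proj
    (mdifferentiableAt_proj _) (FiberBundle.mdifferentiableAt_extend 𝓘(ℝ, E) E u.2) X
  have hc : (TotalSpace.proj : TangentBundle 𝓘(ℝ, E) M → M) ∘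
      (fun x : M ↦ (⟨x, FiberBundle.extend E u.2 x⟩ : TangentBundle 𝓘(ℝ, E) M)) = id := rfl
  rw [hc, mfderiv_id, FiberBundle.extend_apply_self] at h
  have h2 := mfderiv_proj_verticalLift u (cov (FiberBundle.extend E u.2) u.proj X)
  refine (map_sub (mfderiv 𝓘(ℝ, E).tangent 𝓘(ℝ, E)
      (TotalSpace.proj : TangentBundle 𝓘(ℝ, E) M → M) u) _ _).trans ?_
  refine Eq.trans (congrArg₂ (fun a b : TangentSpace 𝓘(ℝ, E) u.proj ↦ a - b) h.symm h2) ?_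
  exact sub_zero X

theorem verticalLift_injective (u : TangentBundle 𝓘(ℝ, E) M) :
    Function.Injective (verticalLift u) := by
  have h : ∀ (p : M) (v X : E),
      mfderiv 𝓘(ℝ, E).tangent 𝓘(ℝ, E) (fun z : TangentBundle 𝓘(ℝ, E) M ↦
        (trivializationAt E (TangentSpace 𝓘(ℝ, E)) p z).2) ⟨p, v⟩
        (mfderiv 𝓘(ℝ, E) 𝓘(ℝ, E).tangent
          (fun v : E ↦ (⟨p, v⟩ : TangentBundle 𝓘(ℝ, E) M)) v X) = X := by
    intro p v X
    have hd : MDifferentiableAt 𝓘(ℝ, E).tangent 𝓘(ℝ, E)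
        (fun z : TangentBundle 𝓘(ℝ, E) M ↦
          (trivializationAt E (TangentSpace 𝓘(ℝ, E)) p z).2) ⟨p, v⟩ := by
      have h1 : MDifferentiableAt 𝓘(ℝ, E).tangent 𝓘(ℝ, E).tangent
        (fun z : TangentBundle 𝓘(ℝ, E) M ↦ z) ⟨p, v⟩ := mdifferentiableAt_id
      rw [mdifferentiableAt_totalSpace] at h1
      exact h1.2
    have hc : (fun z : TangentBundle 𝓘(ℝ, E) M ↦
          (trivializationAt E (TangentSpace 𝓘(ℝ, E)) p z).2) ∘
        (fun v : E ↦ (⟨p, v⟩ : TangentBundle 𝓘(ℝ, E) M)) = id :=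
      funext (trivializationAt_fibre p)
    have h := mfderiv_comp_apply (I := 𝓘(ℝ, E)) (I' := 𝓘(ℝ, E).tangent) (I'' := 𝓘(ℝ, E))
      (f := fun v : E ↦ (⟨p, v⟩ : TangentBundle 𝓘(ℝ, E) M)) v
      hd (mdifferentiableAt_fibreInclusion p v) X
    rw [hc, mfderiv_id] at h
    exact h.symm
  intro X X' e
  have e₁ := h u.proj u.2 X
  have e₂ := h u.proj u.2 X'
  exact e₁.symm.trans ((congrArg (mfderiv 𝓘(ℝ, E).tangent 𝓘(ℝ, E)
    (fun z : TangentBundle 𝓘(ℝ, E) M ↦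
      (trivializationAt E (TangentSpace 𝓘(ℝ, E)) u.proj z).2) u) e).trans e₂)

theorem bijective_horizontalLift_coprod_verticalLift [FiniteDimensional ℝ E]
    (cov : CovariantDerivative 𝓘(ℝ, E) E (TangentSpace 𝓘(ℝ, E) : M → Type _))
    (u : TangentBundle 𝓘(ℝ, E) M) :
    Function.Bijective
      ((horizontalLift cov u).toLinearMap.coprod (verticalLift u).toLinearMap) := by
  have : FiniteDimensional ℝ (TangentSpace 𝓘(ℝ, E) u.proj) := ‹FiniteDimensional ℝ E›
  have : FiniteDimensional ℝ (TangentSpace 𝓘(ℝ, E).tangent u) :=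
    inferInstanceAs (FiniteDimensional ℝ (E × E))
  have inj : Function.Injective
      ((horizontalLift cov u).toLinearMap.coprod (verticalLift u).toLinearMap) := by
    refine (injective_iff_map_eq_zero _).2 ?_
    rintro ⟨X, Z⟩ h
    have h' : horizontalLift cov u X + verticalLift u Z = 0 := h
    have hX := congrArg (mfderiv 𝓘(ℝ, E).tangent 𝓘(ℝ, E)
      (TotalSpace.proj : TangentBundle 𝓘(ℝ, E) M → M) u) h'
    rw [map_add, mfderiv_proj_horizontalLift, mfderiv_proj_verticalLift, add_zero, map_zero] at hX
    subst hX
    rw [map_zero, zero_add] at h'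
    rw [verticalLift_injective u (h'.trans (map_zero _).symm)]
    rfl
  refine ⟨inj, (LinearMap.injective_iff_surjective_of_finrank_eq_finrank ?_).1 inj⟩
  rfl

/-- The horizontal and vertical distributions are complementary: the isomorphism
`(X, Z) ↦ X^H + Z^V` from `T_p M × T_p M` to `T_u TM`. -/
def liftEquiv [FiniteDimensional ℝ E]
    (cov : CovariantDerivative 𝓘(ℝ, E) E (TangentSpace 𝓘(ℝ, E) : M → Type _))
    (u : TangentBundle 𝓘(ℝ, E) M) :
    (TangentSpace 𝓘(ℝ, E) u.proj × TangentSpace 𝓘(ℝ, E) u.proj) ≃ₗ[ℝ]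
      TangentSpace 𝓘(ℝ, E).tangent u :=
  LinearEquiv.ofBijective
    ((horizontalLift cov u).toLinearMap.coprod (verticalLift u).toLinearMap)
    (bijective_horizontalLift_coprod_verticalLift cov u)

/-- `J₁` on `TM`: `X^H ↦ -(JX)^H`, `X^V ↦ (JX)^V`. -/
def liftJ₁ [FiniteDimensional ℝ E]
    (cov : CovariantDerivative 𝓘(ℝ, E) E (TangentSpace 𝓘(ℝ, E) : M → Type _))
    (J : Π x : M, TangentSpace 𝓘(ℝ, E) x →L[ℝ] TangentSpace 𝓘(ℝ, E) x)
    (u : TangentBundle 𝓘(ℝ, E) M) :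
    TangentSpace 𝓘(ℝ, E).tangent u →ₗ[ℝ] TangentSpace 𝓘(ℝ, E).tangent u :=
  (liftEquiv cov u).conj ((-(J u.proj : _ →ₗ[ℝ] _)).prodMap (J u.proj : _ →ₗ[ℝ] _))

/-- `J₂` on `TM`: `X^H ↦ X^V`, `X^V ↦ -X^H`. -/
def liftJ₂ [FiniteDimensional ℝ E]
    (cov : CovariantDerivative 𝓘(ℝ, E) E (TangentSpace 𝓘(ℝ, E) : M → Type _))
    (u : TangentBundle 𝓘(ℝ, E) M) :
    TangentSpace 𝓘(ℝ, E).tangent u →ₗ[ℝ] TangentSpace 𝓘(ℝ, E).tangent u :=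
  (liftEquiv cov u).conj ((-LinearMap.snd ℝ _ _).prod (LinearMap.fst ℝ _ _))

/-- `J₃` on `TM`: `X^H ↦ (JX)^V`, `X^V ↦ (JX)^H`. -/
def liftJ₃ [FiniteDimensional ℝ E]
    (cov : CovariantDerivative 𝓘(ℝ, E) E (TangentSpace 𝓘(ℝ, E) : M → Type _))
    (J : Π x : M, TangentSpace 𝓘(ℝ, E) x →L[ℝ] TangentSpace 𝓘(ℝ, E) x)
    (u : TangentBundle 𝓘(ℝ, E) M) :
    TangentSpace 𝓘(ℝ, E).tangent u →ₗ[ℝ] TangentSpace 𝓘(ℝ, E).tangent u :=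
  (liftEquiv cov u).conj
    (((J u.proj : _ →ₗ[ℝ] _) ∘ₗ LinearMap.snd ℝ _ _).prod
      ((J u.proj : _ →ₗ[ℝ] _) ∘ₗ LinearMap.fst ℝ _ _))

section Formulas

variable [FiniteDimensional ℝ E]
  (cov : CovariantDerivative 𝓘(ℝ, E) E (TangentSpace 𝓘(ℝ, E) : M → Type _))
  (J : Π x : M, TangentSpace 𝓘(ℝ, E) x →L[ℝ] TangentSpace 𝓘(ℝ, E) x)
  (u : TangentBundle 𝓘(ℝ, E) M) (X : TangentSpace 𝓘(ℝ, E) u.proj)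

theorem liftEquiv_apply (X Z : TangentSpace 𝓘(ℝ, E) u.proj) :
    liftEquiv cov u (X, Z) = horizontalLift cov u X + verticalLift u Z := rfl

theorem liftEquiv_symm_horizontalLift :
    (liftEquiv cov u).symm (horizontalLift cov u X) = (X, 0) :=
  (LinearEquiv.symm_apply_eq _).2 (by simp [liftEquiv_apply])

theorem liftEquiv_symm_verticalLift :
    (liftEquiv cov u).symm (verticalLift u X) = (0, X) :=
  (LinearEquiv.symm_apply_eq _).2 (by simp [liftEquiv_apply])

theorem liftJ₁_horizontalLift :
    liftJ₁ cov J u (horizontalLift cov u X) = -horizontalLift cov u (J u.proj X) := by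
  simp [liftJ₁, LinearEquiv.conj_apply, liftEquiv_symm_horizontalLift, liftEquiv_apply]

theorem liftJ₁_verticalLift :
    liftJ₁ cov J u (verticalLift u X) = verticalLift u (J u.proj X) := by
  simp [liftJ₁, LinearEquiv.conj_apply, liftEquiv_symm_verticalLift, liftEquiv_apply]

theorem liftJ₂_horizontalLift :
    liftJ₂ cov u (horizontalLift cov u X) = verticalLift u X := by
  simp [liftJ₂, LinearEquiv.conj_apply, liftEquiv_symm_horizontalLift, liftEquiv_apply]

theorem liftJ₂_verticalLift :
    liftJ₂ cov u (verticalLift u X) = -horizontalLift cov u X := by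
  simp [liftJ₂, LinearEquiv.conj_apply, liftEquiv_symm_verticalLift, liftEquiv_apply]

theorem liftJ₃_horizontalLift :
    liftJ₃ cov J u (horizontalLift cov u X) = verticalLift u (J u.proj X) := by
  simp [liftJ₃, LinearEquiv.conj_apply, liftEquiv_symm_horizontalLift, liftEquiv_apply]

theorem liftJ₃_verticalLift :
    liftJ₃ cov J u (verticalLift u X) = horizontalLift cov u (J u.proj X) := by
  simp [liftJ₃, LinearEquiv.conj_apply, liftEquiv_symm_verticalLift, liftEquiv_apply]

theorem liftJ₁_sq (hJ : IsAlmostComplex J) (w : TangentSpace 𝓘(ℝ, E).tangent u) :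
    liftJ₁ cov J u (liftJ₁ cov J u w) = -w := by
  obtain ⟨⟨X, Z⟩, rfl⟩ := (liftEquiv cov u).surjective w
  simp [liftEquiv_apply, liftJ₁_horizontalLift, liftJ₁_verticalLift, hJ.sq]
  abel

theorem liftJ₂_sq (w : TangentSpace 𝓘(ℝ, E).tangent u) :
    liftJ₂ cov u (liftJ₂ cov u w) = -w := by
  obtain ⟨⟨X, Z⟩, rfl⟩ := (liftEquiv cov u).surjective w
  simp [liftEquiv_apply, liftJ₂_horizontalLift, liftJ₂_verticalLift]
  abel

theorem liftJ₁_liftJ₂ (w : TangentSpace 𝓘(ℝ, E).tangent u) :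
    liftJ₁ cov J u (liftJ₂ cov u w) = liftJ₃ cov J u w := by
  obtain ⟨⟨X, Z⟩, rfl⟩ := (liftEquiv cov u).surjective w
  simp [liftEquiv_apply, liftJ₁_horizontalLift, liftJ₁_verticalLift, liftJ₂_horizontalLift,
    liftJ₂_verticalLift, liftJ₃_horizontalLift, liftJ₃_verticalLift]

theorem liftJ₂_liftJ₁ (w : TangentSpace 𝓘(ℝ, E).tangent u) :
    liftJ₂ cov u (liftJ₁ cov J u w) = -liftJ₃ cov J u w := by
  obtain ⟨⟨X, Z⟩, rfl⟩ := (liftEquiv cov u).surjective w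
  simp [liftEquiv_apply, liftJ₁_horizontalLift, liftJ₁_verticalLift, liftJ₂_horizontalLift,
    liftJ₂_verticalLift, liftJ₃_horizontalLift, liftJ₃_verticalLift]
  abel

end Formulas

end Lifts

end

/-! Everything is computed in the frame of horizontal and vertical lifts. In a chart of $TM$ induced
by a chart of $M$, with Christoffel symbol $G$, one has $X^H=(X,-G(x)(y)X)$ and $Z^V=(0,Z)$. The
brackets are Dombrowski's: $[X^H,Y^H]=[X,Y]^H-(R(X,Y)y)^V$, $[X^H,Z^V]=(\nabla_XZ)^V$ and
$[Z^V,W^V]=0$ (`lieBracket_liftFrame`). In this frame each $J_\alpha$ is a matrix $S(x)$ that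
depends on the base point only. The Nijenhuis tensor is tensorial, so it may be evaluated on frame
fields with constant coefficients; the result is `frameNijenhuis`, an expression in $S$, $dS$, $G$
and $R(\cdot,\cdot)y$. The bridge to the manifold is `isComplexStructure_conj_iff`.

For $J_2$ only $N_2(u^H,v^H)=-(R(u,v)y)^V$ is needed; the remaining terms cancel by
torsion-freeness.

For $J_1$ the mixed component of $N_1$ gives $(\nabla_{Jv}J)a=-J(\nabla_vJ)a$. With the form
$F(v,a,b)=g((\nabla_vJ)a,b)$, symmetric in $a,b$ and compatible with $J^2=-1$, this forces $F=0$
(`cubic_eq_zero`, `covJ_eq_zero`). Once $\nabla J=0$, the curvature commutes with $J$, and the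
symmetries of $R$ allow $J$ to be moved from any slot of $g(R(u,v)w,z)$ to any other
(`curvatureLike_move`). The horizontal component of the condition,
$-R(u,v)+JR(Ju,v)+JR(u,Jv)+R(Ju,Jv)=0$, then reads $-4R=0$ (`curvatureLike_eq_zero`).

For $J_3$ the vertical pairs give $R=0$ at once and also $(\nabla_{Ju}J)v=(\nabla_{Jv}J)u$; with the
mixed component this yields the same identity for $\nabla J$ as for $J_1$. Conversely, $R=0$ and
$\nabla J=0$ make every term cancel. -/

noncomputable section

open scoped Topology

set_option maxSynthPendingDepth 3

/-! ### Algebra of curvature-like tensors -/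

section Algebra

variable {V : Type*}

/-- A tensor with the symmetries of a curvature tensor is symmetric under exchange of pairs. -/
theorem curvatureLike_pair_symm {B : V → V → V → V → ℝ}
    (h₁₂ : ∀ u v w z, B u v w z = -B v u w z) (h₃₄ : ∀ u v w z, B u v w z = -B u v z w)
    (hB : ∀ u v w z, B u v w z + B v w u z + B w u v z = 0) (u v w z : V) :
    B u v w z = B w z u v := by
  -- The classical octahedron argument: four Bianchi identities, one for each choice of the last
  -- argument, combined with the two skew-symmetries.
  linarith [hB u v w z, hB v w z u, hB w z u v, hB z u v w, h₁₂ u v w z, h₁₂ v w u z,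
    h₁₂ w u v z, h₁₂ w z u v, h₁₂ z u v w, h₁₂ u z w v, h₁₂ v z u w, h₁₂ z v w u, h₁₂ u w v z,
    h₃₄ u v w z, h₃₄ v w u z, h₃₄ w u v z, h₃₄ w z u v, h₃₄ z u v w, h₃₄ v z u w, h₃₄ z v w u,
    h₃₄ u w v z, h₃₄ v w z u, h₃₄ z u w v, h₃₄ u w z v, h₃₄ w z v u, h₃₄ v z w u, h₃₄ u v z w,
    h₁₂ v w z u, h₁₂ u w z v, h₁₂ z u w v, h₁₂ w z v u]

/-- A curvature-like tensor for which an anti-involution `j` may be moved within the last pair may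
have `j` moved from the first to the last argument. -/
theorem curvatureLike_move {B : V → V → V → V → ℝ} {j : V → V}
    (h₁₂ : ∀ u v w z, B u v w z = -B v u w z) (h₃₄ : ∀ u v w z, B u v w z = -B u v z w)
    (hB : ∀ u v w z, B u v w z + B v w u z + B w u v z = 0)
    (hj : ∀ u v w z, B u v (j w) z = B u v w (j z)) (u v w z : V) :
    B (j u) v w z = B u v w (j z) := by
  have hp := curvatureLike_pair_symm h₁₂ h₃₄ hB
  have hj' : ∀ u v w z, B (j u) v w z = B u (j v) w z := fun u v w z ↦ by
    rw [hp, hj, ← hp]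
  -- Let $P$ be $B$ with `j` in the first pair and $Q$ with `j` in the last pair; the slot within a
  -- pair is immaterial. Bianchi with `j` in the last argument says that the cyclic sum of $Q$ is 0,
  -- and the sum of the other three identities then says the same of $P$. Subtracting this from a
  -- single identity leaves $P=Q$.
  have e : ∀ u v w, B (j u) v w z = B u v w (j z) := fun w u v ↦ by
    linarith [hB (j u) v w z, hB u (j v) w z, hB u v (j w) z, hB u v w (j z), hj' u v w z,
      hj' v w u z, hj' w u v z, hj u v w z, hj v w u z, hj w u v z]
  exact e u v w

/-- Moving every `j` to the last slot turns each of the three mixed terms of `hQ` into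
$B(u,v,w,j^2z)=-B(u,v,w,z)$, so `hQ` becomes $-4B=0$. -/
theorem curvatureLike_eq_zero {B : V → V → V → V → ℝ} {j : V → V}
    (h₁₂ : ∀ u v w z, B u v w z = -B v u w z) (h₃₄ : ∀ u v w z, B u v w z = -B u v z w)
    (hB : ∀ u v w z, B u v w z + B v w u z + B w u v z = 0)
    (hj : ∀ u v w z, B u v (j w) z = B u v w (j z))
    (hjj : ∀ u v w z, B u v w (j (j z)) = -B u v w z)
    (hQ : ∀ u v w z, -B u v w z + B (j u) v w (j z) + B u (j v) w (j z) + B (j u) (j v) w z = 0)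
    (u v w z : V) : B u v w z = 0 := by
  have hm := curvatureLike_move h₁₂ h₃₄ hB hj
  have hm' : ∀ u v w z, B u (j v) w z = B u v w (j z) := fun u v w z ↦ by
    rw [h₁₂, hm, ← h₁₂]
  linarith [hQ u v w z, hm u v w (j z), hm' u v w (j z), hm u (j v) w z, hjj u v w z]

/-- A trilinear form which is symmetric in the last two arguments, and changes sign when `j` is
moved from the first or the second to the last argument, vanishes. -/
theorem cubic_eq_zero {F : V → V → V → ℝ} {j : V → V}
    (h₂₃ : ∀ u v w, F u v w = F u w v)
    (h₁ : ∀ u v w, F (j u) v w = -F u v (j w)) (h₂ : ∀ u v w, F u (j v) w = -F u v (j w))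
    (u v w : V) : F (j u) v w = 0 := by
  -- $F(ju,v,w)=-F(u,v,jw)=F(u,jv,w)$; interchanging $v$ and $w$ first gives
  -- $F(ju,v,w)=-F(u,w,jv)=-F(u,jv,w)$.
  linarith [h₁ u v w, h₂ u v w, h₁ u w v, h₂₃ (j u) v w, h₂₃ u (j v) w]

end Algebra

/-! ### Connections on open subsets of a vector space -/

section Local

variable {E : Type*} [NormedAddCommGroup E] [NormedSpace ℝ E]

/-- The covariant derivative `(∇_v J) a` for the connection with Christoffel symbol `G`, in the
convention `∇_v Y = dY(v) + G Y v`. -/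
def localCovJ (J : E → E →L[ℝ] E) (G : E → E →L[ℝ] E →L[ℝ] E) (x v a : E) : E :=
  fderiv ℝ J x v a + G x (J x a) v - J x (G x a v)

/-- The curvature `R(u, v)w` of the connection with Christoffel symbol `G`. -/
def localCurvature (G : E → E →L[ℝ] E →L[ℝ] E) (x u v w : E) : E :=
  fderiv ℝ G x u w v - fderiv ℝ G x v w u + G x (G x w v) u - G x (G x w u) v

/-- Coordinate expression near `e` of an almost Norden structure `(J, g)` and the Christoffel symbol
`G` of its Levi-Civita connection. -/
structure IsLocalNorden (J : E → E →L[ℝ] E) (g : E → E →L[ℝ] E →L[ℝ] ℝ)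
    (G : E → E →L[ℝ] E →L[ℝ] E) (e : E) : Prop where
  contDiffAt_J : ContDiffAt ℝ 2 J e
  contDiffAt_g : ContDiffAt ℝ 2 g e
  contDiffAt_G : ContDiffAt ℝ 1 G e
  sq : ∀ᶠ x in 𝓝 e, ∀ a, J x (J x a) = -a
  symm : ∀ᶠ x in 𝓝 e, ∀ a b, g x a b = g x b a
  nondegenerate : ∀ a, (∀ b, g e a b = 0) → a = 0
  norden : ∀ᶠ x in 𝓝 e, ∀ a b, g x (J x a) (J x b) = -g x a b
  torsion_free : ∀ᶠ x in 𝓝 e, ∀ a b, G x a b = G x b a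
  metric : ∀ᶠ x in 𝓝 e, ∀ v a b,
    fderiv ℝ g x v a b = g x (G x a v) b + g x a (G x b v)

namespace IsLocalNorden

variable {J : E → E →L[ℝ] E} {g : E → E →L[ℝ] E →L[ℝ] ℝ} {G : E → E →L[ℝ] E →L[ℝ] E} {e : E}

theorem differentiableAt_J (h : IsLocalNorden J g G e) : DifferentiableAt ℝ J e :=
  h.contDiffAt_J.differentiableAt two_ne_zero

theorem differentiableAt_g (h : IsLocalNorden J g G e) : DifferentiableAt ℝ g e :=
  h.contDiffAt_g.differentiableAt two_ne_zero

theorem differentiableAt_G (h : IsLocalNorden J g G e) : DifferentiableAt ℝ G e :=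
  h.contDiffAt_G.differentiableAt one_ne_zero

/-- Torsion-freeness holds on a neighbourhood of `e`, so it may be differentiated. -/
theorem fderiv_G_symm (h : IsLocalNorden J g G e) (u a b : E) :
    fderiv ℝ G e u a b = fderiv ℝ G e u b a := by
  have key : ∀ a b, HasFDerivAt (fun x ↦ G x a b)
      (((fderiv ℝ G e).flip a).flip b) e := fun a b ↦ by
    have := (h.differentiableAt_G.hasFDerivAt.clm_apply (hasFDerivAt_const a e)).clm_apply
      (hasFDerivAt_const b e)
    convert this using 1
    ext; simp
  have h2 := (key a b).unique ((key b a).congr_of_eventuallyEq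
    (h.torsion_free.mono fun x hx ↦ hx a b))
  simpa using congr($h2 u)

theorem curvature_bianchi (h : IsLocalNorden J g G e) (u v w : E) :
    localCurvature G e u v w + localCurvature G e v w u + localCurvature G e w u v = 0 := by
  have hs := h.torsion_free.self_of_nhds
  simp only [localCurvature]
  rw [h.fderiv_G_symm u w v, h.fderiv_G_symm v u w, h.fderiv_G_symm w v u, hs w v, hs u w, hs v u]
  abel

theorem curvature_antisymm (u v w : E) :
    localCurvature G e u v w = -localCurvature G e v u w := by
  simp only [localCurvature]; abel

theorem fderiv_fderiv_g (h : IsLocalNorden J g G e) (u v a b : E) :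
    fderiv ℝ (fderiv ℝ g) e u v a b =
      fderiv ℝ g e u (G e a v) b + g e (fderiv ℝ G e u a v) b
        + fderiv ℝ g e u a (G e b v) + g e a (fderiv ℝ G e u b v) := by
  have hg := h.differentiableAt_g.hasFDerivAt
  have hG := h.differentiableAt_G.hasFDerivAt
  have hg2 : DifferentiableAt ℝ (fderiv ℝ g) e :=
    (h.contDiffAt_g.fderiv_right (m := 1) (by norm_num)).differentiableAt one_ne_zero
  have l := ((hg2.hasFDerivAt.clm_apply (hasFDerivAt_const v e)).clm_apply
      (hasFDerivAt_const a e)).clm_apply (hasFDerivAt_const b e)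
  have hGc : ∀ a, HasFDerivAt (fun x ↦ G x a v) _ e := fun a ↦
    (hG.clm_apply (hasFDerivAt_const a e)).clm_apply (hasFDerivAt_const v e)
  have r := ((hg.clm_apply (hGc a)).clm_apply (hasFDerivAt_const b e)).add
    ((hg.clm_apply (hasFDerivAt_const a e)).clm_apply (hGc b))
  have := l.unique (r.congr_of_eventuallyEq (h.metric.mono fun x hx ↦ hx v a b))
  have := congr($this u)
  simp at this
  linarith

/-- The Ricci identity for the parallel tensor $g$: second derivatives of $g$ commute, and
antisymmetrising the differentiated equation $\nabla g=0$ leaves only the curvature terms. -/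
theorem curvature_skew (h : IsLocalNorden J g G e) (u v a b : E) :
    g e (localCurvature G e u v a) b = -g e (localCurvature G e u v b) a := by
  have hs := (h.contDiffAt_g.isSymmSndFDerivAt (by simp)).eq u v
  have hs : fderiv ℝ (fderiv ℝ g) e u v a b = fderiv ℝ (fderiv ℝ g) e v u a b := by rw [hs]
  rw [h.fderiv_fderiv_g, h.fderiv_fderiv_g] at hs
  have hm := h.metric.self_of_nhds
  have hsy := h.symm.self_of_nhds
  rw [hsy _ a]
  simp only [localCurvature, hm, map_add, map_sub, add_apply,
    sub_apply] at hs ⊢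
  linarith

theorem fderiv_fderiv_J (h : IsLocalNorden J g G e)
    (hT : ∀ᶠ x in 𝓝 e, ∀ v a, localCovJ J G x v a = 0) (u v a : E) :
    fderiv ℝ (fderiv ℝ J) e u v a =
      fderiv ℝ J e u (G e a v) + J e (fderiv ℝ G e u a v)
        - (fderiv ℝ G e u (J e a) v + G e (fderiv ℝ J e u a) v) := by
  have hJ := h.differentiableAt_J.hasFDerivAt
  have hG := h.differentiableAt_G.hasFDerivAt
  have hJ2 : DifferentiableAt ℝ (fderiv ℝ J) e :=
    (h.contDiffAt_J.fderiv_right (m := 1) (by norm_num)).differentiableAt one_ne_zero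
  have l := (hJ2.hasFDerivAt.clm_apply (hasFDerivAt_const v e)).clm_apply (hasFDerivAt_const a e)
  have r := (hJ.clm_apply
      ((hG.clm_apply (hasFDerivAt_const a e)).clm_apply (hasFDerivAt_const v e))).sub
    ((hG.clm_apply (hJ.clm_apply (hasFDerivAt_const a e))).clm_apply (hasFDerivAt_const v e))
  have := l.unique (r.congr_of_eventuallyEq (hT.mono fun x hx ↦ by
    have := hx v a
    simp only [localCovJ] at this
    rw [add_sub_assoc, add_eq_zero_iff_eq_neg, neg_sub] at this
    exact this))
  have := congr($this u)
  simp at this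
  rw [this]
  abel

/-- The Ricci identity for $J$. Parallelism is required near `e`, not only at `e`, since it is
differentiated once more. -/
theorem curvature_J (h : IsLocalNorden J g G e)
    (hT : ∀ᶠ x in 𝓝 e, ∀ v a, localCovJ J G x v a = 0) (u v a : E) :
    localCurvature G e u v (J e a) = J e (localCurvature G e u v a) := by
  have hs := (h.contDiffAt_J.isSymmSndFDerivAt (by simp)).eq u v
  have hs : fderiv ℝ (fderiv ℝ J) e u v a = fderiv ℝ (fderiv ℝ J) e v u a := by rw [hs]
  rw [h.fderiv_fderiv_J hT, h.fderiv_fderiv_J hT] at hs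
  have hT0 : ∀ v a, fderiv ℝ J e v a = J e (G e a v) - G e (J e a) v := fun v a ↦ by
    have := hT.self_of_nhds v a
    simp only [localCovJ] at this
    rwa [add_sub_assoc, add_eq_zero_iff_eq_neg, neg_sub] at this
  simp only [localCurvature, hT0, map_add, map_sub, sub_apply] at hs ⊢
  rw [← sub_eq_zero] at hs ⊢
  rw [← neg_eq_zero, ← hs]
  abel

/-- The covariant derivative of $J^2=-1$. -/
theorem covJ_J (h : IsLocalNorden J g G e) (v a : E) :
    localCovJ J G e v (J e a) = -J e (localCovJ J G e v a) := by
  have hJ := h.differentiableAt_J.hasFDerivAt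
  have := (hJ.clm_apply (hJ.clm_apply (hasFDerivAt_const a e))).unique
    ((hasFDerivAt_const (-a) e).congr_of_eventuallyEq (h.sq.mono fun x hx ↦ hx a))
  have := congr($this v)
  simp at this
  have hsq := h.sq.self_of_nhds
  simp only [localCovJ, map_add, map_sub, hsq, map_neg, neg_apply]
  rw [← sub_eq_zero, ← this]
  abel

/-- The Norden condition with $b$ replaced by $Jb$: here $J$ is self-adjoint, in contrast with the
skew-adjointness of the Hermitian case. -/
theorem g_J (h : IsLocalNorden J g G e) :
    ∀ᶠ x in 𝓝 e, ∀ a b, g x (J x a) b = g x a (J x b) := by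
  filter_upwards [h.norden, h.sq] with x h1 h2 a b
  have := h1 a (J x b)
  rw [h2] at this
  simpa using this

/-- The covariant derivative of the self-adjointness of $J$, with $\nabla g=0$. -/
theorem covJ_symm (h : IsLocalNorden J g G e) (v a b : E) :
    g e (localCovJ J G e v a) b = g e a (localCovJ J G e v b) := by
  have hJ := h.differentiableAt_J.hasFDerivAt
  have hg := h.differentiableAt_g.hasFDerivAt
  have c := fun a : E ↦ hasFDerivAt_const (𝕜 := ℝ) a e
  have := ((hg.clm_apply (hJ.clm_apply (c a))).clm_apply (c b)).unique
    (((hg.clm_apply (c a)).clm_apply (hJ.clm_apply (c b))).congr_of_eventuallyEq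
      (h.g_J.mono fun x hx ↦ hx a b))
  have := congr($this v)
  have hm := h.metric.self_of_nhds
  have hgJ := h.g_J.self_of_nhds
  simp [hm, hgJ] at this
  simp only [localCovJ, map_add, map_sub, add_apply,
    sub_apply, hgJ]
  linarith

/-- The conditions of complexity of `J₁`, or of `J₃`, in the mixed directions force `∇J = 0`. -/
theorem covJ_eq_zero (h : IsLocalNorden J g G e)
    (h₁ : ∀ v a, localCovJ J G e (J e v) a = -J e (localCovJ J G e v a)) (v a : E) :
    localCovJ J G e v a = 0 := by
  have hgJ := h.g_J.self_of_nhds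
  have hsq := h.sq.self_of_nhds
  have key : ∀ v a, localCovJ J G e (J e v) a = 0 := fun v a ↦ h.nondegenerate _ fun b ↦
    cubic_eq_zero (F := fun v a b ↦ g e (localCovJ J G e v a) b) (j := J e)
      (fun u v w ↦ by simp only [h.covJ_symm u v w, h.symm.self_of_nhds v])
      (fun u v w ↦ by simp only [h₁, map_neg, neg_apply, hgJ])
      (fun u v w ↦ by simp only [h.covJ_J, map_neg, neg_apply, hgJ]) v a b
  -- Every vector is in the image of $J$: $v=J(-Jv)$.
  have := key (-J e v) a
  rwa [map_neg, hsq, neg_neg] at this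

/-- If `J` is parallel near `e`, the condition of complexity of `J₁` in horizontal directions forces
the curvature to vanish. -/
theorem curvature_eq_zero (h : IsLocalNorden J g G e)
    (hT : ∀ᶠ x in 𝓝 e, ∀ v a, localCovJ J G x v a = 0)
    (hQ : ∀ u v w, -localCurvature G e u v w + J e (localCurvature G e (J e u) v w)
      + J e (localCurvature G e u (J e v) w) + localCurvature G e (J e u) (J e v) w = 0)
    (u v w : E) : localCurvature G e u v w = 0 := by
  have hgJ := h.g_J.self_of_nhds
  have hsq := h.sq.self_of_nhds
  refine h.nondegenerate _ fun z ↦ curvatureLike_eq_zero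
    (B := fun u v w z ↦ g e (localCurvature G e u v w) z) (j := J e) ?_ h.curvature_skew ?_ ?_ ?_ ?_
    u v w z
  · intro u v w z
    rw [curvature_antisymm, map_neg, neg_apply]
  · intro u v w z
    have := congr(g e $(h.curvature_bianchi u v w) z)
    simpa using this
  · intro u v w z
    simp only [h.curvature_J hT, hgJ]
  · intro u v w z
    simp [hsq]
  · intro u v w z
    have := congr(g e $(hQ u v w) z)
    simpa [hgJ] using this

end IsLocalNorden

end Local

/-! ### The Nijenhuis tensor on a vector space -/

section VectorSpaceNijenhuis

variable {F : Type*} [NormedAddCommGroup F] [NormedSpace ℝ F]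

/-- The Nijenhuis tensor of a field of endomorphisms of a vector space. -/
def vectorSpaceNijenhuis (A : F → F →L[ℝ] F) (X Y : F → F) (z : F) : F :=
  lieBracket ℝ X Y z + A z (lieBracket ℝ (fun y ↦ A y (X y)) Y z)
    + A z (lieBracket ℝ X (fun y ↦ A y (Y y)) z)
    - lieBracket ℝ (fun y ↦ A y (X y)) (fun y ↦ A y (Y y)) z

/-- The derivatives of $X$ and $Y$ cancel because $A^2=-1$; only their values at `z` survive, which
is tensoriality. -/
theorem vectorSpaceNijenhuis_eq {A : F → F →L[ℝ] F} {X Y : F → F} {z : F}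
    (hA : DifferentiableAt ℝ A z) (hsq : ∀ v, A z (A z v) = -v) (hX : DifferentiableAt ℝ X z)
    (hY : DifferentiableAt ℝ Y z) :
    vectorSpaceNijenhuis A X Y z =
      A z (fderiv ℝ A z (X z) (Y z)) - A z (fderiv ℝ A z (Y z) (X z))
        - fderiv ℝ A z (A z (X z)) (Y z) + fderiv ℝ A z (A z (Y z)) (X z) := by
  have dX := (hA.hasFDerivAt.clm_apply hX.hasFDerivAt).fderiv
  have dY := (hA.hasFDerivAt.clm_apply hY.hasFDerivAt).fderiv
  simp only [vectorSpaceNijenhuis, lieBracket, dX, dY]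
  simp [hsq]
  abel

/-- The Nijenhuis tensor of an almost complex structure is tensorial. -/
theorem vectorSpaceNijenhuis_congr {A : F → F →L[ℝ] F} {X Y X' Y' : F → F} {z : F}
    (hA : DifferentiableAt ℝ A z) (hsq : ∀ v, A z (A z v) = -v) (hX : DifferentiableAt ℝ X z)
    (hY : DifferentiableAt ℝ Y z) (hX' : DifferentiableAt ℝ X' z) (hY' : DifferentiableAt ℝ Y' z)
    (eX : X z = X' z) (eY : Y z = Y' z) :
    vectorSpaceNijenhuis A X Y z = vectorSpaceNijenhuis A X' Y' z := by
  rw [vectorSpaceNijenhuis_eq hA hsq hX hY, vectorSpaceNijenhuis_eq hA hsq hX' hY', eX, eY]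

end VectorSpaceNijenhuis

/-! ### The horizontal-vertical frame over an open subset of a vector space -/

section Frame

variable {E : Type*} [NormedAddCommGroup E] [NormedSpace ℝ E] (G : E → E →L[ℝ] E →L[ℝ] E)

/-- The map `(X, Z) ↦ X^H + Z^V` at the point `z = (x, y)`, where `X^H = (X, -G x y X)` and
`Z^V = (0, Z)`. -/
def liftFrame (z : E × E) : E × E →L[ℝ] E × E :=
  ContinuousLinearMap.id ℝ (E × E)
    - (ContinuousLinearMap.inr ℝ E E).comp ((G z.1 z.2).comp (ContinuousLinearMap.fst ℝ E E))

/-- The inverse of `liftFrame`. -/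
def liftFrameInv (z : E × E) : E × E →L[ℝ] E × E :=
  ContinuousLinearMap.id ℝ (E × E)
    + (ContinuousLinearMap.inr ℝ E E).comp ((G z.1 z.2).comp (ContinuousLinearMap.fst ℝ E E))

@[simp] theorem liftFrame_apply (z p : E × E) :
    liftFrame G z p = (p.1, p.2 - G z.1 z.2 p.1) := by
  ext <;> simp [liftFrame]

@[simp] theorem liftFrameInv_apply (z p : E × E) :
    liftFrameInv G z p = (p.1, p.2 + G z.1 z.2 p.1) := by
  ext <;> simp [liftFrameInv]

theorem liftFrameInv_liftFrame (z p : E × E) : liftFrameInv G z (liftFrame G z p) = p := by simp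

theorem liftFrame_liftFrameInv (z p : E × E) : liftFrame G z (liftFrameInv G z p) = p := by simp

variable {G}

theorem differentiableAt_christoffel {z : E × E} (hG : DifferentiableAt ℝ G z.1) :
    DifferentiableAt ℝ (fun z : E × E ↦ G z.1 z.2) z :=
  (hG.comp z differentiableAt_fst).clm_apply differentiableAt_snd

theorem differentiableAt_liftFrame {z : E × E} (hG : DifferentiableAt ℝ G z.1) :
    DifferentiableAt ℝ (liftFrame G) z :=
  (differentiableAt_const _).sub ((differentiableAt_const _).clm_comp
    ((differentiableAt_christoffel hG).clm_comp (differentiableAt_const _)))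

theorem differentiableAt_liftFrameInv {z : E × E} (hG : DifferentiableAt ℝ G z.1) :
    DifferentiableAt ℝ (liftFrameInv G) z :=
  (differentiableAt_const _).add ((differentiableAt_const _).clm_comp
    ((differentiableAt_christoffel hG).clm_comp (differentiableAt_const _)))

/-- The coefficients `P` depend on the base point only, so the fibre direction `w.2` enters solely
through the linear dependence of the frame on $y$. -/
theorem fderiv_liftFrame_field {z : E × E} (hG : DifferentiableAt ℝ G z.1) {P : E → E × E}
    (hP : DifferentiableAt ℝ P z.1) (w : E × E) :
    fderiv ℝ (fun z : E × E ↦ liftFrame G z (P z.1)) z w =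
      ((fderiv ℝ P z.1 w.1).1, (fderiv ℝ P z.1 w.1).2
        - (fderiv ℝ G z.1 w.1 z.2 (P z.1).1 + G z.1 w.2 (P z.1).1
          + G z.1 z.2 (fderiv ℝ P z.1 w.1).1)) := by
  have hP' : HasFDerivAt (fun z : E × E ↦ P z.1) _ z := hP.hasFDerivAt.comp z hasFDerivAt_fst
  have hG' : HasFDerivAt (fun z : E × E ↦ G z.1) _ z := hG.hasFDerivAt.comp z hasFDerivAt_fst
  have := hP'.fst.prodMk (hP'.snd.sub ((hG'.clm_apply hasFDerivAt_snd).clm_apply hP'.fst))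
  have h2 : HasFDerivAt (𝕜 := ℝ) (fun z : E × E ↦ liftFrame G z (P z.1)) _ z :=
    this.congr_of_eventuallyEq (.of_forall fun x ↦ liftFrame_apply G x (P x.1))
  rw [h2.fderiv]
  simp
  abel

/-- The Lie bracket of the fields `X^H + Z^V` for `(X, Z) = P` and `(X, Z) = Q`, expressed in the
horizontal-vertical frame. -/
theorem lieBracket_liftFrame {z : E × E} (hG : DifferentiableAt ℝ G z.1) {P Q : E → E × E}
    (hP : DifferentiableAt ℝ P z.1) (hQ : DifferentiableAt ℝ Q z.1) :
    lieBracket ℝ (fun z : E × E ↦ liftFrame G z (P z.1)) (fun z : E × E ↦ liftFrame G z (Q z.1)) z =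
      liftFrame G z ((fderiv ℝ Q z.1 (P z.1).1).1 - (fderiv ℝ P z.1 (Q z.1).1).1,
        (fderiv ℝ Q z.1 (P z.1).1).2 + G z.1 (Q z.1).2 (P z.1).1
          - ((fderiv ℝ P z.1 (Q z.1).1).2 + G z.1 (P z.1).2 (Q z.1).1)
          - localCurvature G z.1 (P z.1).1 (Q z.1).1 z.2) := by
  rw [lieBracket, fderiv_liftFrame_field hG hP, fderiv_liftFrame_field hG hQ]
  simp [localCurvature]
  abel

/-- The endomorphism field on `E × E` which is given by `S` in the horizontal-vertical frame. -/
def frameConj (G : E → E →L[ℝ] E →L[ℝ] E) (S : E → E × E →L[ℝ] E × E) (z : E × E) :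
    E × E →L[ℝ] E × E :=
  (liftFrame G z).comp ((S z.1).comp (liftFrameInv G z))

theorem frameConj_liftFrame (S : E → E × E →L[ℝ] E × E) (z p : E × E) :
    frameConj G S z (liftFrame G z p) = liftFrame G z (S z.1 p) := by
  simp only [frameConj, ContinuousLinearMap.comp_apply, liftFrameInv_liftFrame]

theorem differentiableAt_frameConj {S : E → E × E →L[ℝ] E × E} {z : E × E}
    (hG : DifferentiableAt ℝ G z.1) (hS : DifferentiableAt ℝ S z.1) :
    DifferentiableAt ℝ (frameConj G S) z :=
  (differentiableAt_liftFrame hG).clm_comp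
    ((hS.comp z differentiableAt_fst).clm_comp (differentiableAt_liftFrameInv hG))

theorem frameConj_sq {S : E → E × E →L[ℝ] E × E} {z : E × E} (hS : ∀ p, S z.1 (S z.1 p) = -p)
    (w : E × E) : frameConj G S z (frameConj G S z w) = -w := by
  rw [← liftFrame_liftFrameInv G z w, frameConj_liftFrame, frameConj_liftFrame, hS, map_neg]

/-- The Nijenhuis tensor of `frameConj G S` at `(x, y)`, in the horizontal-vertical frame. -/
def frameNijenhuis (G : E → E →L[ℝ] E →L[ℝ] E) (S : E → E × E →L[ℝ] E × E) (x y : E)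
    (p q : E × E) : E × E :=
  let D : E → E × E → E × E := fun v r ↦ fderiv ℝ S x v r
  let R : E → E → E := fun u v ↦ localCurvature G x u v y
  (0, G x q.2 p.1 - G x p.2 q.1 - R p.1 q.1)
    + S x (-(D q.1 p).1, G x q.2 (S x p).1 - ((D q.1 p).2 + G x (S x p).2 q.1) - R (S x p).1 q.1)
    + S x ((D p.1 q).1, (D p.1 q).2 + G x (S x q).2 p.1 - G x p.2 (S x q).1 - R p.1 (S x q).1)
    - ((D (S x p).1 q).1 - (D (S x q).1 p).1,
        (D (S x p).1 q).2 + G x (S x q).2 (S x p).1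
          - ((D (S x q).1 p).2 + G x (S x p).2 (S x q).1) - R (S x p).1 (S x q).1)

/-- The structure sends a frame field with constant coefficients `p` to one with coefficients `S x
p`, still functions of the base point, so all four brackets fall under `lieBracket_liftFrame`. -/
theorem vectorSpaceNijenhuis_frameConj {S : E → E × E →L[ℝ] E × E} {z : E × E}
    (hG : DifferentiableAt ℝ G z.1) (hS : DifferentiableAt ℝ S z.1) (p q : E × E) :
    vectorSpaceNijenhuis (frameConj G S) (fun z ↦ liftFrame G z p) (fun z ↦ liftFrame G z q) z =
      liftFrame G z (frameNijenhuis G S z.1 z.2 p q) := by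
  have hc : ∀ p : E × E, DifferentiableAt ℝ (fun _ : E ↦ p) z.1 :=
    fun p ↦ differentiableAt_const p
  have hSp : ∀ p : E × E, DifferentiableAt ℝ (fun x ↦ S x p) z.1 :=
    fun p ↦ hS.clm_apply (hc p)
  have hD : ∀ p v, fderiv ℝ (fun x ↦ S x p) z.1 v = fderiv ℝ S z.1 v p := fun p v ↦ by
    rw [(hS.hasFDerivAt.clm_apply (hasFDerivAt_const p z.1)).fderiv]; simp
  simp only [vectorSpaceNijenhuis, frameConj_liftFrame]
  rw [lieBracket_liftFrame hG (hc p) (hc q), lieBracket_liftFrame hG (hSp p) (hc q),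
    lieBracket_liftFrame hG (hc p) (hSp q), lieBracket_liftFrame hG (hSp p) (hSp q)]
  simp only [frameConj_liftFrame, ← map_add, ← map_sub, hD, frameNijenhuis, fderiv_fun_const]
  simp

/-- The condition for `frameConj G S` to have vanishing Nijenhuis tensor at a point. -/
theorem vectorSpaceNijenhuis_frameConj_eq_zero_iff {S : E → E × E →L[ℝ] E × E} {z : E × E}
    (hG : DifferentiableAt ℝ G z.1) (hS : DifferentiableAt ℝ S z.1)
    (hsq : ∀ p, S z.1 (S z.1 p) = -p) {X Y : E × E → E × E} (hX : DifferentiableAt ℝ X z)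
    (hY : DifferentiableAt ℝ Y z) :
    vectorSpaceNijenhuis (frameConj G S) X Y z = 0 ↔
      frameNijenhuis G S z.1 z.2 (liftFrameInv G z (X z)) (liftFrameInv G z (Y z)) = 0 := by
  have hc : ∀ p : E × E, DifferentiableAt ℝ (fun z ↦ liftFrame G z p) z :=
    fun p ↦ (differentiableAt_liftFrame hG).clm_apply (differentiableAt_const p)
  -- By tensoriality $X$ and $Y$ are replaced by the constant-coefficient frame fields with the same
  -- values at `z`.
  rw [vectorSpaceNijenhuis_congr (differentiableAt_frameConj hG hS) (frameConj_sq hsq) hX hY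
    (hc (liftFrameInv G z (X z))) (hc (liftFrameInv G z (Y z))) (liftFrame_liftFrameInv G z _).symm
    (liftFrame_liftFrameInv G z _).symm, vectorSpaceNijenhuis_frameConj hG hS]
  constructor
  · intro h
    rw [← liftFrameInv_liftFrame G z (frameNijenhuis _ _ _ _ _ _), h, map_zero]
  · intro h
    rw [h, map_zero]

end Frame

/-! ### The three structures in the horizontal-vertical frame -/

section FrameStructures

variable {E : Type*} [NormedAddCommGroup E] [NormedSpace ℝ E]

/-- The structure `J₁` in the horizontal-vertical frame. -/
def frameJ₁ (J : E → E →L[ℝ] E) (x : E) : E × E →L[ℝ] E × E :=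
  (ContinuousLinearMap.inr ℝ E E).comp ((J x).comp (ContinuousLinearMap.snd ℝ E E))
    - (ContinuousLinearMap.inl ℝ E E).comp ((J x).comp (ContinuousLinearMap.fst ℝ E E))

/-- The structure `J₂` in the horizontal-vertical frame. -/
def frameJ₂ (_ : E) : E × E →L[ℝ] E × E :=
  (-ContinuousLinearMap.snd ℝ E E).prod (ContinuousLinearMap.fst ℝ E E)

/-- The structure `J₃` in the horizontal-vertical frame. -/
def frameJ₃ (J : E → E →L[ℝ] E) (x : E) : E × E →L[ℝ] E × E :=
  (ContinuousLinearMap.inl ℝ E E).comp ((J x).comp (ContinuousLinearMap.snd ℝ E E))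
    + (ContinuousLinearMap.inr ℝ E E).comp ((J x).comp (ContinuousLinearMap.fst ℝ E E))

variable {J : E → E →L[ℝ] E} {x : E}

@[simp] theorem frameJ₁_apply (p : E × E) : frameJ₁ J x p = (-J x p.1, J x p.2) := by
  ext <;> simp [frameJ₁]

@[simp] theorem frameJ₂_apply (p : E × E) : frameJ₂ x p = (-p.2, p.1) := rfl

@[simp] theorem frameJ₃_apply (p : E × E) : frameJ₃ J x p = (J x p.2, J x p.1) := by
  ext <;> simp [frameJ₃]

theorem hasFDerivAt_clm_conj {E' F F' : Type*} [NormedAddCommGroup E'] [NormedSpace ℝ E']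
    [NormedAddCommGroup F] [NormedSpace ℝ F] [NormedAddCommGroup F'] [NormedSpace ℝ F']
    (i : E →L[ℝ] F) (k : F' →L[ℝ] E) {J : E' → E →L[ℝ] E} {x : E'} (hJ : DifferentiableAt ℝ J x) :
    DifferentiableAt ℝ (fun x ↦ i.comp ((J x).comp k)) x ∧
      ∀ v p, fderiv ℝ (fun x ↦ i.comp ((J x).comp k)) x v p = i (fderiv ℝ J x v (k p)) := by
  have := (hasFDerivAt_const i x).clm_comp (hJ.hasFDerivAt.clm_comp (hasFDerivAt_const k x))
  refine ⟨this.differentiableAt, fun v p ↦ ?_⟩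
  rw [this.fderiv]
  simp

theorem differentiableAt_frameJ₁ (hJ : DifferentiableAt ℝ J x) :
    DifferentiableAt ℝ (frameJ₁ J) x :=
  (hasFDerivAt_clm_conj _ _ hJ).1.sub (hasFDerivAt_clm_conj _ _ hJ).1

theorem differentiableAt_frameJ₃ (hJ : DifferentiableAt ℝ J x) :
    DifferentiableAt ℝ (frameJ₃ J) x :=
  (hasFDerivAt_clm_conj _ _ hJ).1.add (hasFDerivAt_clm_conj _ _ hJ).1

theorem fderiv_frameJ₁ (hJ : DifferentiableAt ℝ J x) (v : E) (p : E × E) :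
    fderiv ℝ (frameJ₁ J) x v p = (-fderiv ℝ J x v p.1, fderiv ℝ J x v p.2) := by
  have h1 := hasFDerivAt_clm_conj (ContinuousLinearMap.inr ℝ E E)
    (ContinuousLinearMap.snd ℝ E E) hJ
  have h2 := hasFDerivAt_clm_conj (ContinuousLinearMap.inl ℝ E E)
    (ContinuousLinearMap.fst ℝ E E) hJ
  have := fderiv_fun_sub h1.1 h2.1
  have h3 : fderiv ℝ (frameJ₁ J) x v p = _ := congr($this v p)
  rw [h3, sub_apply, sub_apply, h1.2, h2.2]
  simp

theorem fderiv_frameJ₃ (hJ : DifferentiableAt ℝ J x) (v : E) (p : E × E) :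
    fderiv ℝ (frameJ₃ J) x v p = (fderiv ℝ J x v p.2, fderiv ℝ J x v p.1) := by
  have h1 := hasFDerivAt_clm_conj (ContinuousLinearMap.inl ℝ E E)
    (ContinuousLinearMap.snd ℝ E E) hJ
  have h2 := hasFDerivAt_clm_conj (ContinuousLinearMap.inr ℝ E E)
    (ContinuousLinearMap.fst ℝ E E) hJ
  have := fderiv_fun_add h1.1 h2.1
  have h3 : fderiv ℝ (frameJ₃ J) x v p = _ := congr($this v p)
  rw [h3, add_apply, add_apply, h1.2, h2.2]
  simp

end FrameStructures

/-! ### Integrability of the three structures in the frame, in terms of $R$ and $\nabla J$ -/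

namespace IsLocalNorden

variable {E : Type*} [NormedAddCommGroup E] [NormedSpace ℝ E]
  {J : E → E →L[ℝ] E} {g : E → E →L[ℝ] E →L[ℝ] ℝ} {G : E → E →L[ℝ] E →L[ℝ] E} {e : E}

theorem fderiv_J_eq (hT : ∀ v a, localCovJ J G e v a = 0) (v a : E) :
    fderiv ℝ J e v a = J e (G e a v) - G e (J e a) v := by
  have := hT v a
  simp only [localCovJ] at this
  rwa [add_sub_assoc, add_eq_zero_iff_eq_neg, neg_sub] at this

/-- The mixed brackets contribute the horizontal vector $G(u)v-G(v)u$, which is zero by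
torsion-freeness; $[u^V,v^V]=0$, and $[u^H,v^H]$ supplies the curvature. -/
theorem frameNijenhuis_frameJ₂_horizontal (h : IsLocalNorden J g G e) (u v y : E) :
    frameNijenhuis G frameJ₂ e y (u, 0) (v, 0) = (0, -localCurvature G e u v y) := by
  have hs := h.torsion_free.self_of_nhds
  have hD : fderiv ℝ (frameJ₂ : E → E × E →L[ℝ] E × E) e = 0 :=
    congrFun (fderiv_fun_const ((-ContinuousLinearMap.snd ℝ E E).prod
      (ContinuousLinearMap.fst ℝ E E))) e
  simp [frameNijenhuis, hD, localCurvature]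
  rw [hs u v]
  simp

theorem frameNijenhuis_frameJ₂_eq_zero (h : IsLocalNorden J g G e)
    (hR : ∀ u v w, localCurvature G e u v w = 0) (y : E) (p q : E × E) :
    frameNijenhuis G frameJ₂ e y p q = 0 := by
  have hs := h.torsion_free.self_of_nhds
  have hD : fderiv ℝ (frameJ₂ : E → E × E →L[ℝ] E × E) e = 0 :=
    congrFun (fderiv_fun_const ((-ContinuousLinearMap.snd ℝ E E).prod
      (ContinuousLinearMap.fst ℝ E E))) e
  simp [frameNijenhuis, hD, hR]
  rw [hs p.1 q.1, hs p.2 q.2, hs q.2 p.1, hs q.1 p.2]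
  constructor <;> abel

theorem frameNijenhuis_frameJ₁_eq_zero (h : IsLocalNorden J g G e)
    (hT : ∀ v a, localCovJ J G e v a = 0) (hR : ∀ u v w, localCurvature G e u v w = 0)
    (y : E) (p q : E × E) : frameNijenhuis G (frameJ₁ J) e y p q = 0 := by
  have hs := h.torsion_free.self_of_nhds
  have hsq := h.sq.self_of_nhds
  simp [frameNijenhuis, fderiv_frameJ₁ h.differentiableAt_J, hR, fderiv_J_eq hT, hsq]
  constructor
  · rw [hs (J e p.1) q.1, hs (J e q.1) p.1, hs p.1 q.1, hs (J e p.1)]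
    abel
  · abel

theorem frameNijenhuis_frameJ₃_eq_zero (h : IsLocalNorden J g G e)
    (hT : ∀ v a, localCovJ J G e v a = 0) (hR : ∀ u v w, localCurvature G e u v w = 0)
    (y : E) (p q : E × E) : frameNijenhuis G (frameJ₃ J) e y p q = 0 := by
  have hs := h.torsion_free.self_of_nhds
  have hsq := h.sq.self_of_nhds
  simp [frameNijenhuis, fderiv_frameJ₃ h.differentiableAt_J, hR, fderiv_J_eq hT, hsq]
  constructor
  · rw [hs p.1 q.1, hs (J e p.2)]; abel
  · rw [hs (J e p.2) q.1, hs (J e q.2) p.1]; abel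

/-- The vertical component of $N_1(v^H,a^V)$ is $(\nabla_{Jv}J)a+J(\nabla_vJ)a$. Curvature enters
only through $R(\cdot,\cdot)y$, so the zero section $y=0$ suffices. -/
theorem covJ_eq_zero_of_frameJ₁ (h : IsLocalNorden J g G e)
    (hN : ∀ p q, frameNijenhuis G (frameJ₁ J) e 0 p q = 0) (v a : E) :
    localCovJ J G e v a = 0 := by
  refine h.covJ_eq_zero (fun v a ↦ ?_) v a
  have := congr(($(hN (v, 0) (0, a))).2)
  have hsq := h.sq.self_of_nhds
  simp [frameNijenhuis, fderiv_frameJ₁ h.differentiableAt_J, localCurvature] at this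
  simp only [localCovJ, map_add, map_sub, hsq]
  rw [← sub_eq_zero, ← this]
  abel

theorem curvature_neg_left (u v w : E) :
    localCurvature G e (-u) v w = -localCurvature G e u v w := by
  simp [localCurvature]; abel

theorem curvature_neg_right (u v w : E) :
    localCurvature G e u (-v) w = -localCurvature G e u v w := by
  simp [localCurvature]; abel

/-- The vertical component of $N_1(u^H,v^H)$ involves the curvature alone and is the hypothesis of
`curvature_eq_zero`. -/
theorem curvature_eq_zero_of_frameJ₁ (h : IsLocalNorden J g G e)
    (hT : ∀ᶠ x in 𝓝 e, ∀ v a, localCovJ J G x v a = 0)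
    (hN : ∀ y p q, frameNijenhuis G (frameJ₁ J) e y p q = 0) (u v w : E) :
    localCurvature G e u v w = 0 := by
  refine h.curvature_eq_zero hT (fun u v w ↦ ?_) u v w
  have := congr(($(hN w (u, 0) (v, 0))).2)
  simp [frameNijenhuis, fderiv_frameJ₁ h.differentiableAt_J, curvature_neg_left,
    curvature_neg_right] at this
  exact this

theorem curvature_eq_zero_of_frameJ₃ (h : IsLocalNorden J g G e)
    (hN : ∀ y p q, frameNijenhuis G (frameJ₃ J) e y p q = 0) (u v w : E) :
    localCurvature G e u v w = 0 := by
  have hsq := h.sq.self_of_nhds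
  -- The vertical vectors are chosen so that $J_3$ maps them to $u^H$ and $v^H$. The two brackets
  -- inside $J_3$ are vertical, hence become horizontal, and the vertical component is just
  -- $R(u,v)w$; no knowledge of $\nabla J$ is needed.
  have := congr(($(hN w (0, -J e u) (0, -J e v))).2)
  simpa [frameNijenhuis, fderiv_frameJ₃ h.differentiableAt_J, hsq, localCurvature] using this

/-- Neither component is enough by itself: vertical pairs give the exchange rule `h₁`, mixed pairs
give `h₂`, and their composite is the identity that `covJ_eq_zero` needs. -/
theorem covJ_eq_zero_of_frameJ₃ (h : IsLocalNorden J g G e)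
    (hN : ∀ p q, frameNijenhuis G (frameJ₃ J) e 0 p q = 0) (v a : E) :
    localCovJ J G e v a = 0 := by
  have hsq := h.sq.self_of_nhds
  have hs := h.torsion_free.self_of_nhds
  have h₁ : ∀ u v, localCovJ J G e (J e u) v = localCovJ J G e (J e v) u := fun u v ↦ by
    have := congr(($(hN (0, u) (0, v))).1)
    simp [frameNijenhuis, fderiv_frameJ₃ h.differentiableAt_J, localCurvature] at this
    simp only [localCovJ]
    rw [hs (J e u) (J e v), ← sub_eq_zero, ← neg_eq_zero, ← this]
    abel
  have h₂ : ∀ u v, localCovJ J G e (J e v) u = -J e (localCovJ J G e u v) := fun u v ↦ by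
    have := congr(($(hN (u, 0) (0, v))).2)
    simp [frameNijenhuis, fderiv_frameJ₃ h.differentiableAt_J, localCurvature] at this
    simp only [localCovJ, map_add, map_sub, hsq]
    rw [← sub_eq_zero, ← this, hs u (J e v)]
    abel
  exact h.covJ_eq_zero (fun v a ↦ (h₁ v a).trans (h₂ v a)) v a

end IsLocalNorden

/-! ### Charts of the base manifold -/

section Chart

set_option linter.unusedSectionVars false

variable {E : Type*} [NormedAddCommGroup E] [NormedSpace ℝ E]
  {M : Type*} [TopologicalSpace M] [ChartedSpace E M] [IsManifold 𝓘(ℝ, E) ∞ M]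

/-- The coordinate vectors at `q` of the chart at `p`. -/
def chartFrame (p q : M) : E →L[ℝ] TangentSpace 𝓘(ℝ, E) q :=
  (trivializationAt E (TangentSpace 𝓘(ℝ, E)) p).symmL ℝ q

/-- The components, in the chart at `p`, of a tangent vector at `q`. -/
def chartCoord (p q : M) : TangentSpace 𝓘(ℝ, E) q →L[ℝ] E :=
  (trivializationAt E (TangentSpace 𝓘(ℝ, E)) p).continuousLinearMapAt ℝ q

/-- The components of a vector field in the chart at `p`. -/
def fieldCoord (p : M) (Y : Π q : M, TangentSpace 𝓘(ℝ, E) q) (e : E) : E :=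
  chartCoord p ((extChartAt 𝓘(ℝ, E) p).symm e) (Y ((extChartAt 𝓘(ℝ, E) p).symm e))

variable {p q : M}

theorem chartCoord_chartFrame (hq : q ∈ (chartAt E p).source) (a : E) :
    chartCoord p q (chartFrame p q a) = a :=
  (trivializationAt E (TangentSpace 𝓘(ℝ, E)) p).continuousLinearMapAt_symmL hq a

theorem chartFrame_chartCoord (hq : q ∈ (chartAt E p).source) (v : TangentSpace 𝓘(ℝ, E) q) :
    chartFrame p q (chartCoord p q v) = v :=
  (trivializationAt E (TangentSpace 𝓘(ℝ, E)) p).symmL_continuousLinearMapAt hq v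

theorem chartCoord_injective (hq : q ∈ (chartAt E p).source) :
    Function.Injective (chartCoord (E := E) p q) := fun v w h ↦ by
  have := congrArg (chartFrame (E := E) p q) h
  rwa [chartFrame_chartCoord hq, chartFrame_chartCoord hq] at this

theorem extChartAt_symm_extChartAt (hq : q ∈ (chartAt E p).source) :
    (extChartAt 𝓘(ℝ, E) p).symm (extChartAt 𝓘(ℝ, E) p q) = q :=
  (extChartAt 𝓘(ℝ, E) p).left_inv (by rwa [extChartAt_source])

theorem fieldCoord_extChartAt (hq : q ∈ (chartAt E p).source)
    (Y : Π q : M, TangentSpace 𝓘(ℝ, E) q) :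
    fieldCoord p Y (extChartAt 𝓘(ℝ, E) p q) = chartCoord p q (Y q) := by
  have : ∀ q', q' = q → chartCoord p q' (Y q') = chartCoord p q (Y q) := fun q' h ↦ by rw [h]
  exact this _ (extChartAt_symm_extChartAt hq)

theorem eventually_mem_chart_source (hq : q ∈ (chartAt E p).source) :
    ∀ᶠ x in 𝓝 q, x ∈ (chartAt E p).source :=
  (chartAt E p).open_source.mem_nhds hq

theorem tendsto_extChartAt_symm (hq : q ∈ (chartAt E p).source) :
    Filter.Tendsto (extChartAt 𝓘(ℝ, E) p).symm (𝓝 (extChartAt 𝓘(ℝ, E) p q)) (𝓝 q) := by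
  have := continuousAt_extChartAt_symm' (I := 𝓘(ℝ, E)) (x := p) (x' := q)
    (by rwa [extChartAt_source])
  rwa [ContinuousAt, extChartAt_symm_extChartAt hq] at this

theorem eventually_extChartAt_of_eventually (hq : q ∈ (chartAt E p).source) {P : E → Prop}
    (h : ∀ᶠ x in 𝓝 q, P (extChartAt 𝓘(ℝ, E) p x)) :
    ∀ᶠ e in 𝓝 (extChartAt 𝓘(ℝ, E) p q), P e := by
  have ht : (extChartAt 𝓘(ℝ, E) p).target ∈ 𝓝 (extChartAt 𝓘(ℝ, E) p q) :=
    extChartAt_target_mem_nhds' ((extChartAt 𝓘(ℝ, E) p).map_source (by rwa [extChartAt_source]))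
  filter_upwards [(tendsto_extChartAt_symm hq).eventually h, ht] with e he ht
  rwa [(extChartAt 𝓘(ℝ, E) p).right_inv ht] at he

section Comp

variable {F : Type*} [NormedAddCommGroup F] [NormedSpace ℝ F] {f : E → F}

theorem contMDiffAt_comp_extChartAt_iff (hq : q ∈ (chartAt E p).source) :
    ContMDiffAt 𝓘(ℝ, E) 𝓘(ℝ, F) ∞ (fun x : M ↦ f (extChartAt 𝓘(ℝ, E) p x)) q ↔
      ContDiffAt ℝ ∞ f (extChartAt 𝓘(ℝ, E) p q) := by
  have hφ : ContMDiffAt 𝓘(ℝ, E) 𝓘(ℝ, E) ∞ (extChartAt 𝓘(ℝ, E) p) q := contMDiffAt_extChartAt' hq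
  have ht : (extChartAt 𝓘(ℝ, E) p).target ∈ 𝓝 (extChartAt 𝓘(ℝ, E) p q) :=
    extChartAt_target_mem_nhds' ((extChartAt 𝓘(ℝ, E) p).map_source (by rwa [extChartAt_source]))
  refine ⟨fun h ↦ ?_, fun h ↦ h.contMDiffAt.comp q hφ⟩
  have hs : ContMDiffAt 𝓘(ℝ, E) 𝓘(ℝ, E) ∞ (extChartAt 𝓘(ℝ, E) p).symm
      (extChartAt 𝓘(ℝ, E) p q) := (contMDiffOn_extChartAt_symm p).contMDiffAt ht
  rw [← extChartAt_symm_extChartAt hq] at h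
  refine (h.comp _ hs).contDiffAt.congr_of_eventuallyEq ?_
  filter_upwards [ht] with e he
  simp only [Function.comp, (extChartAt 𝓘(ℝ, E) p).right_inv he]

theorem mdifferentiableAt_comp_extChartAt_iff (hq : q ∈ (chartAt E p).source) :
    MDifferentiableAt 𝓘(ℝ, E) 𝓘(ℝ, F) (fun x : M ↦ f (extChartAt 𝓘(ℝ, E) p x)) q ↔
      DifferentiableAt ℝ f (extChartAt 𝓘(ℝ, E) p q) := by
  have hφ : MDifferentiableAt 𝓘(ℝ, E) 𝓘(ℝ, E) (extChartAt 𝓘(ℝ, E) p) q :=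
    mdifferentiableAt_extChartAt hq
  have ht : (extChartAt 𝓘(ℝ, E) p).target ∈ 𝓝 (extChartAt 𝓘(ℝ, E) p q) :=
    extChartAt_target_mem_nhds' ((extChartAt 𝓘(ℝ, E) p).map_source (by rwa [extChartAt_source]))
  refine ⟨fun h ↦ ?_, fun h ↦ h.mdifferentiableAt.comp q hφ⟩
  have hs : ContMDiffAt 𝓘(ℝ, E) 𝓘(ℝ, E) ∞ (extChartAt 𝓘(ℝ, E) p).symm
      (extChartAt 𝓘(ℝ, E) p q) := (contMDiffOn_extChartAt_symm p).contMDiffAt ht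
  rw [← extChartAt_symm_extChartAt hq] at h
  refine (h.comp _ (hs.mdifferentiableAt (by simp))).differentiableAt.congr_of_eventuallyEq ?_
  filter_upwards [ht] with e he
  simp only [Function.comp, (extChartAt 𝓘(ℝ, E) p).right_inv he]

theorem mfderiv_extChartAt_apply (hq : q ∈ (chartAt E p).source) (v : TangentSpace 𝓘(ℝ, E) q) :
    mfderiv 𝓘(ℝ, E) 𝓘(ℝ, E) (extChartAt 𝓘(ℝ, E) p) q v = chartCoord p q v := by
  rw [chartCoord, TangentBundle.continuousLinearMapAt_trivializationAt hq]
  rfl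

theorem mfderiv_comp_extChartAt (hq : q ∈ (chartAt E p).source)
    (hf : DifferentiableAt ℝ f (extChartAt 𝓘(ℝ, E) p q)) (v : TangentSpace 𝓘(ℝ, E) q) :
    mfderiv 𝓘(ℝ, E) 𝓘(ℝ, F) (fun x : M ↦ f (extChartAt 𝓘(ℝ, E) p x)) q v =
      fderiv ℝ f (extChartAt 𝓘(ℝ, E) p q) (chartCoord p q v) := by
  have := mfderiv_comp_apply (I' := 𝓘(ℝ, E)) (g := f) q hf.mdifferentiableAt
    (mdifferentiableAt_extChartAt (I := 𝓘(ℝ, E)) hq) v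
  rw [mfderiv_extChartAt_apply hq, mfderiv_eq_fderiv] at this
  exact this

end Comp

theorem trivializationAt_snd_eventuallyEq (hq : q ∈ (chartAt E p).source)
    (Y : Π q : M, TangentSpace 𝓘(ℝ, E) q) :
    (fun x ↦ (trivializationAt E (TangentSpace 𝓘(ℝ, E)) p ⟨x, Y x⟩).2) =ᶠ[𝓝 q]
      fun x ↦ fieldCoord p Y (extChartAt 𝓘(ℝ, E) p x) := by
  filter_upwards [eventually_mem_chart_source hq] with x hx
  rw [fieldCoord_extChartAt hx]
  exact ((trivializationAt E (TangentSpace 𝓘(ℝ, E)) p).continuousLinearMapAt_apply_of_mem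
    (R := ℝ) hx _).symm

theorem smoothFieldAt_iff (hq : q ∈ (chartAt E p).source) {Y : Π q : M, TangentSpace 𝓘(ℝ, E) q} :
    SmoothFieldAt 𝓘(ℝ, E) Y q ↔ ContDiffAt ℝ ∞ (fieldCoord p Y) (extChartAt 𝓘(ℝ, E) p q) := by
  rw [← contMDiffAt_comp_extChartAt_iff hq]
  refine ((trivializationAt E (TangentSpace 𝓘(ℝ, E)) p).contMDiffAt_section_iff hq).trans ?_
  exact (trivializationAt_snd_eventuallyEq hq Y).contMDiffAt_iff

theorem mdifferentiableAt_field_iff (hq : q ∈ (chartAt E p).source)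
    {Y : Π q : M, TangentSpace 𝓘(ℝ, E) q} :
    MDifferentiableAt 𝓘(ℝ, E) 𝓘(ℝ, E).tangent (fun x ↦ (⟨x, Y x⟩ : TangentBundle 𝓘(ℝ, E) M)) q ↔
      DifferentiableAt ℝ (fieldCoord p Y) (extChartAt 𝓘(ℝ, E) p q) := by
  rw [← mdifferentiableAt_comp_extChartAt_iff hq]
  refine ((trivializationAt E (TangentSpace 𝓘(ℝ, E)) p).mdifferentiableAt_section_iff
    𝓘(ℝ, E) Y hq).trans ?_
  exact (trivializationAt_snd_eventuallyEq hq Y).mdifferentiableAt_iff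

/-- The vector field with components `f` in the chart at `p`. -/
def chartField (p : M) (f : E → E) (q : M) : TangentSpace 𝓘(ℝ, E) q :=
  chartFrame p q (f (extChartAt 𝓘(ℝ, E) p q))

theorem fieldCoord_chartField (hq : q ∈ (chartAt E p).source) (f : E → E) :
    fieldCoord p (chartField p f) =ᶠ[𝓝 (extChartAt 𝓘(ℝ, E) p q)] f := by
  refine eventually_extChartAt_of_eventually hq ?_
  filter_upwards [eventually_mem_chart_source hq] with x hx
  rw [fieldCoord_extChartAt hx, chartField, chartCoord_chartFrame hx]

theorem smoothFieldAt_chartField (hq : q ∈ (chartAt E p).source) (a : E) :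
    SmoothFieldAt 𝓘(ℝ, E) (chartField p fun _ ↦ a) q :=
  (smoothFieldAt_iff hq).2 (contDiffAt_const.congr_of_eventuallyEq (fieldCoord_chartField hq _))

theorem SmoothFieldAt.mdifferentiableAt {Y : Π q : M, TangentSpace 𝓘(ℝ, E) q}
    (hY : SmoothFieldAt 𝓘(ℝ, E) Y q) :
    MDifferentiableAt 𝓘(ℝ, E) 𝓘(ℝ, E).tangent (fun x ↦ (⟨x, Y x⟩ : TangentBundle 𝓘(ℝ, E) M)) q :=
  ContMDiffAt.mdifferentiableAt hY (by simp)

/-- Coordinate vector fields commute. -/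
theorem mlieBracket_chartField_const [CompleteSpace E] (hq : q ∈ (chartAt E p).source) (a b : E) :
    mlieBracket 𝓘(ℝ, E) (chartField p fun _ ↦ a) (chartField p fun _ ↦ b) q = 0 := by
  -- Coordinate fields are pullbacks of constant fields by the chart, and the bracket commutes with
  -- pullback.
  have hpull : ∀ a : E, chartField p (fun _ ↦ a) =ᶠ[𝓝 q]
      mpullback 𝓘(ℝ, E) 𝓘(ℝ, E) (extChartAt 𝓘(ℝ, E) p) (fun _ : E ↦ a) := fun a ↦ by
    filter_upwards [eventually_mem_chart_source hq] with x hx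
    have hi : (mfderiv 𝓘(ℝ, E) 𝓘(ℝ, E) (extChartAt 𝓘(ℝ, E) p) x).IsInvertible :=
      isInvertible_mfderiv_extChartAt (by rwa [extChartAt_source])
    have h := mfderiv_extChartAt_apply hx (chartFrame p x a)
    rw [chartCoord_chartFrame hx] at h
    exact (hi.inverse_apply_eq.2 h.symm).symm
  have hd : ∀ a : E, MDifferentiableAt 𝓘(ℝ, E) 𝓘(ℝ, E).tangent
      (fun x ↦ (⟨x, a⟩ : TangentBundle 𝓘(ℝ, E) E)) (extChartAt 𝓘(ℝ, E) p q) := fun a ↦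
    (contMDiffAt_vectorSpace_iff_contDiffAt (V := fun _ : E ↦ a) (n := 1)).2 contDiffAt_const
      |>.mdifferentiableAt one_ne_zero
  have hφ : ContMDiffAt 𝓘(ℝ, E) 𝓘(ℝ, E) ∞ (extChartAt 𝓘(ℝ, E) p) q := contMDiffAt_extChartAt' hq
  have hM : IsManifold 𝓘(ℝ, E) (minSmoothness ℝ 2) M := by
    rw [minSmoothness_of_isRCLikeNormedField]; infer_instance
  have hE : IsManifold 𝓘(ℝ, E) (minSmoothness ℝ 2) E := by
    rw [minSmoothness_of_isRCLikeNormedField]; infer_instance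
  have hb : mlieBracket 𝓘(ℝ, E) (fun _ : E ↦ a) (fun _ : E ↦ b) (extChartAt 𝓘(ℝ, E) p q) = 0 := by
    refine (congrFun (mlieBracketWithin_eq_lieBracketWithin (V := fun _ : E ↦ a)
      (W := fun _ : E ↦ b) (s := Set.univ)) (extChartAt 𝓘(ℝ, E) p q)).trans ?_
    simp [lieBracketWithin]
    rfl
  rw [(hpull a).mlieBracket_vectorField_eq (hpull b), ← mpullback_mlieBracket (hd a) (hd b) hφ
    (by rw [minSmoothness_of_isRCLikeNormedField]; 
        exact WithTop.coe_le_coe.2 (le_top : (2 : ℕ∞) ≤ ⊤))]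
  exact (congrArg (mfderiv 𝓘(ℝ, E) 𝓘(ℝ, E) (extChartAt 𝓘(ℝ, E) p) q).inverse hb).trans
    (map_zero _)

end Chart

/-! ### The connection in a chart -/

section Connection

set_option linter.unusedSectionVars false

variable {E : Type*} [NormedAddCommGroup E] [NormedSpace ℝ E] [FiniteDimensional ℝ E]
  {M : Type*} [TopologicalSpace M] [ChartedSpace E M] [IsManifold 𝓘(ℝ, E) ∞ M]
  (cov : CovariantDerivative 𝓘(ℝ, E) E (TangentSpace 𝓘(ℝ, E) : M → Type _)) {p q : M}

/-- The covariant derivatives, in the chart at `p`, of the `i`-th coordinate vector field. -/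
def covCoordField (p : M) (i : Fin (Module.finrank ℝ E)) (q : M) : E →L[ℝ] E :=
  (chartCoord p q).comp
    ((cov (chartField p fun _ ↦ Module.finBasis ℝ E i) q).comp (chartFrame p q))

/-- The Christoffel symbol of `cov` at `q`, in the chart at `p`. -/
def christoffelAt (p q : M) : E →L[ℝ] E →L[ℝ] E :=
  ∑ i, (LinearMap.toContinuousLinearMap ((Module.finBasis ℝ E).coord i)).smulRight
    (covCoordField cov p i q)

/-- The Christoffel symbol of `cov` in the chart at `p`. -/
def christoffel (p : M) (e : E) : E →L[ℝ] E →L[ℝ] E :=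
  christoffelAt cov p ((extChartAt 𝓘(ℝ, E) p).symm e)

theorem christoffel_extChartAt (hq : q ∈ (chartAt E p).source) :
    christoffel cov p (extChartAt 𝓘(ℝ, E) p q) = christoffelAt cov p q := by
  rw [christoffel, extChartAt_symm_extChartAt hq]

theorem fieldCoord_add (Y Z : Π q : M, TangentSpace 𝓘(ℝ, E) q) :
    fieldCoord p (Y + Z) = fieldCoord p Y + fieldCoord p Z :=
  funext fun _ ↦ map_add _ _ _

theorem fieldCoord_smul (f : M → ℝ) (Y : Π q : M, TangentSpace 𝓘(ℝ, E) q) :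
    fieldCoord p (f • Y) = fun e ↦ f ((extChartAt 𝓘(ℝ, E) p).symm e) • fieldCoord p Y e :=
  funext fun _ ↦ map_smul _ _ _

/-- The difference of `cov` and the flat connection of a chart is tensorial. -/
theorem tensorialAt_cov_sub (hq : q ∈ (chartAt E p).source) (v : TangentSpace 𝓘(ℝ, E) q) :
    TensorialAt 𝓘(ℝ, E) E (fun Y ↦ chartCoord p q (cov Y q v)
      - fderiv ℝ (fieldCoord p Y) (extChartAt 𝓘(ℝ, E) p q) (chartCoord p q v)) q where
  add {Y Z} hY hZ := by
    have dY := (mdifferentiableAt_field_iff hq).1 hY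
    have dZ := (mdifferentiableAt_field_iff hq).1 hZ
    have h1 : cov (Y + Z) q = cov Y q + cov Z q := cov.isCovariantDerivativeOnUniv.add hY hZ
    simp only [h1]
    rw [fieldCoord_add, fderiv_add dY dZ, add_apply, map_add, add_apply]
    abel
  smul {f Y} hf hY := by
    have dY := (mdifferentiableAt_field_iff hq).1 hY
    have h1 : cov (f • Y) q = _ := cov.isCovariantDerivativeOnUniv.leibniz hY hf
    have hff : f =ᶠ[𝓝 q] fun x ↦ (f ∘ (extChartAt 𝓘(ℝ, E) p).symm) (extChartAt 𝓘(ℝ, E) p x) := by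
      filter_upwards [eventually_mem_chart_source hq] with x hx
      simp only [Function.comp, extChartAt_symm_extChartAt hx]
    have df : DifferentiableAt ℝ (f ∘ (extChartAt 𝓘(ℝ, E) p).symm) (extChartAt 𝓘(ℝ, E) p q) :=
      (mdifferentiableAt_comp_extChartAt_iff hq).1 (hf.congr_of_eventuallyEq hff.symm)
    have hd : mvfderiv 𝓘(ℝ, E) f q v =
        fderiv ℝ (f ∘ (extChartAt 𝓘(ℝ, E) p).symm) (extChartAt 𝓘(ℝ, E) p q)
          (chartCoord p q v) := by
      rw [← mfderiv_comp_extChartAt hq df v, ← hff.mfderiv_eq]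
      rfl
    have h2 := (df.hasFDerivAt.smul dY.hasFDerivAt).fderiv
    have h3 : fieldCoord p (f • Y) =
        fun e ↦ (f ∘ (extChartAt 𝓘(ℝ, E) p).symm) e • fieldCoord p Y e := fieldCoord_smul f Y
    -- Both connections produce the same Leibniz term $df(v)\,Y$, which cancels in the difference.
    have h4 : fderiv ℝ (fieldCoord p (f • Y)) (extChartAt 𝓘(ℝ, E) p q) (chartCoord p q v) =
        f q • fderiv ℝ (fieldCoord p Y) (extChartAt 𝓘(ℝ, E) p q) (chartCoord p q v)
          + mvfderiv 𝓘(ℝ, E) f q v • chartCoord p q (Y q) := by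
      rw [h3, hd]
      refine congr($h2 (chartCoord p q v)).trans ?_
      rw [add_apply, fieldCoord_extChartAt hq]
      simp only [Function.comp, smul_apply, ContinuousLinearMap.smulRight_apply,
        extChartAt_symm_extChartAt hq]
    have h5 : chartCoord p q (cov (f • Y) q v) =
        f q • chartCoord p q (cov Y q v) + mvfderiv 𝓘(ℝ, E) f q v • chartCoord p q (Y q) := by
      rw [h1, add_apply, map_add]
      simp
    simp only [h4, h5, smul_sub]
    abel

theorem christoffelAt_apply (a w : E) :
    christoffelAt cov p q a w =
      ∑ i, (Module.finBasis ℝ E).coord i a • covCoordField cov p i q w := by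
  simp [christoffelAt]

/-- The covariant derivative in a chart. -/
theorem chartCoord_cov (hq : q ∈ (chartAt E p).source) {Y : Π q : M, TangentSpace 𝓘(ℝ, E) q}
    (hY : MDifferentiableAt 𝓘(ℝ, E) 𝓘(ℝ, E).tangent
      (fun x ↦ (⟨x, Y x⟩ : TangentBundle 𝓘(ℝ, E) M)) q) (v : TangentSpace 𝓘(ℝ, E) q) :
    chartCoord p q (cov Y q v) =
      fderiv ℝ (fieldCoord p Y) (extChartAt 𝓘(ℝ, E) p q) (chartCoord p q v)
        + christoffelAt cov p q (chartCoord p q (Y q)) (chartCoord p q v) := by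
  have hΦ := tensorialAt_cov_sub cov hq v
  set b := Module.finBasis ℝ E
  have hE : ∀ i, MDifferentiableAt 𝓘(ℝ, E) 𝓘(ℝ, E).tangent
      (fun x ↦ (⟨x, chartField p (fun _ ↦ b i) x⟩ : TangentBundle 𝓘(ℝ, E) M)) q :=
    fun i ↦ (smoothFieldAt_chartField hq (b i)).mdifferentiableAt
  have hsm : ∀ i, MDifferentiableAt 𝓘(ℝ, E) 𝓘(ℝ, E).tangent (fun x ↦
      (⟨x, (b.coord i (chartCoord p q (Y q))) • chartField p (fun _ ↦ b i) x⟩ :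
        TangentBundle 𝓘(ℝ, E) M)) q :=
    fun i ↦ MDifferentiableAt.smul_section (mdifferentiableAt_const (c := b.coord i _)) (hE i)
  -- The coefficients are frozen at `q`: tensoriality lets $Y$ be replaced by this combination of
  -- coordinate fields, for which the flat derivative vanishes and the connection gives $G$.
  have hval : Y q = ∑ i, (b.coord i (chartCoord p q (Y q))) • chartField p (fun _ ↦ b i) q := by
    apply chartCoord_injective hq
    rw [map_sum]
    simp only [map_smul, chartField, chartCoord_chartFrame hq]
    exact (b.sum_repr _).symm
  have key := hΦ.pointwise hY (MDifferentiableAt.sum_section fun i _ ↦ hsm i) hval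
  rw [hΦ.sum _ fun i _ ↦ hsm i] at key
  have hterm : ∀ i, chartCoord p q (cov (fun x ↦
        (b.coord i (chartCoord p q (Y q))) • chartField p (fun _ ↦ b i) x) q v)
      - fderiv ℝ (fieldCoord p fun x ↦
        (b.coord i (chartCoord p q (Y q))) • chartField p (fun _ ↦ b i) x)
          (extChartAt 𝓘(ℝ, E) p q) (chartCoord p q v) =
      b.coord i (chartCoord p q (Y q)) • covCoordField cov p i q (chartCoord p q v) := fun i ↦ by
    refine (hΦ.smul (f := fun _ ↦ b.coord i (chartCoord p q (Y q)))
      mdifferentiableAt_const (hE i)).trans ?_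
    rw [(fieldCoord_chartField hq _).fderiv_eq]
    simp [covCoordField, chartFrame_chartCoord hq, b]
  rw [Finset.sum_congr rfl fun i _ ↦ hterm i, ← christoffelAt_apply, sub_eq_iff_eq_add'] at key
  exact key

end Connection

/-! ### The geometric structures in a chart -/

section LocalGeometry

set_option linter.unusedSectionVars false

variable {E : Type*} [NormedAddCommGroup E] [NormedSpace ℝ E]
  {M : Type*} [TopologicalSpace M] [ChartedSpace E M] [IsManifold 𝓘(ℝ, E) ∞ M]
  {p q : M}

/-- The matrix of a field of endomorphisms at `q`, in the chart at `p`. -/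
def endoAt (J : Π x : M, TangentSpace 𝓘(ℝ, E) x →L[ℝ] TangentSpace 𝓘(ℝ, E) x) (p q : M) :
    E →L[ℝ] E :=
  (chartCoord p q).comp ((J q).comp (chartFrame p q))

/-- A field of endomorphisms in the chart at `p`. -/
def chartEndo (J : Π x : M, TangentSpace 𝓘(ℝ, E) x →L[ℝ] TangentSpace 𝓘(ℝ, E) x) (p : M)
    (e : E) : E →L[ℝ] E :=
  endoAt J p ((extChartAt 𝓘(ℝ, E) p).symm e)

/-- A field of bilinear forms at `q`, in the chart at `p`. -/
def formAt (g : Π x : M, TangentSpace 𝓘(ℝ, E) x →L[ℝ] TangentSpace 𝓘(ℝ, E) x →L[ℝ] ℝ) (p q : M) :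
    E →L[ℝ] E →L[ℝ] ℝ :=
  ContinuousLinearMap.bilinearComp (E := E) (F := E) (g q) (chartFrame p q) (chartFrame p q)

/-- A field of bilinear forms in the chart at `p`. -/
def chartForm (g : Π x : M, TangentSpace 𝓘(ℝ, E) x →L[ℝ] TangentSpace 𝓘(ℝ, E) x →L[ℝ] ℝ) (p : M)
    (e : E) : E →L[ℝ] E →L[ℝ] ℝ :=
  formAt g p ((extChartAt 𝓘(ℝ, E) p).symm e)

variable {J : Π x : M, TangentSpace 𝓘(ℝ, E) x →L[ℝ] TangentSpace 𝓘(ℝ, E) x}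
  {g : Π x : M, TangentSpace 𝓘(ℝ, E) x →L[ℝ] TangentSpace 𝓘(ℝ, E) x →L[ℝ] ℝ}

theorem chartEndo_extChartAt (hq : q ∈ (chartAt E p).source) :
    chartEndo J p (extChartAt 𝓘(ℝ, E) p q) = endoAt J p q := by
  rw [chartEndo, extChartAt_symm_extChartAt hq]

theorem chartForm_extChartAt (hq : q ∈ (chartAt E p).source) :
    chartForm g p (extChartAt 𝓘(ℝ, E) p q) = formAt g p q := by
  rw [chartForm, extChartAt_symm_extChartAt hq]

theorem endoAt_apply (a : E) : endoAt J p q a = chartCoord p q (J q (chartFrame p q a)) := rfl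

theorem formAt_apply (a b : E) :
    formAt g p q a b = g q (chartFrame p q a) (chartFrame p q b) := rfl

theorem endoAt_chartCoord (hq : q ∈ (chartAt E p).source) (v : TangentSpace 𝓘(ℝ, E) q) :
    endoAt J p q (chartCoord p q v) = chartCoord p q (J q v) := by
  rw [endoAt_apply, chartFrame_chartCoord hq]

theorem contDiffAt_of_comp_extChartAt {F : Type*} [NormedAddCommGroup F] [NormedSpace ℝ F]
    {f : M → F} (hq : q ∈ (chartAt E p).source) (hf : ContMDiffAt 𝓘(ℝ, E) 𝓘(ℝ, F) ∞ f q) :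
    ContDiffAt ℝ ∞ (fun e ↦ f ((extChartAt 𝓘(ℝ, E) p).symm e)) (extChartAt 𝓘(ℝ, E) p q) := by
  rw [← contMDiffAt_comp_extChartAt_iff hq]
  refine hf.congr_of_eventuallyEq ?_
  filter_upwards [eventually_mem_chart_source hq] with x hx
  rw [extChartAt_symm_extChartAt hx]

/-- In finite dimension a linear map is determined linearly and continuously by its values on a
basis. -/
theorem contDiffAt_clm_of_apply [FiniteDimensional ℝ E] {D F : Type*} [NormedAddCommGroup D]
    [NormedSpace ℝ D] [NormedAddCommGroup F] [NormedSpace ℝ F] {n : WithTop ℕ∞}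
    {f : D → E →L[ℝ] F} {x : D} (h : ∀ a, ContDiffAt ℝ n (fun x ↦ f x a) x) :
    ContDiffAt ℝ n f x := by
  have hd : Module.finrank ℝ E = Module.finrank ℝ (Fin (Module.finrank ℝ E) → ℝ) :=
    (Module.finrank_fin_fun ℝ).symm
  let e₁ := ContinuousLinearEquiv.ofFinrankEq hd
  let e₂ := (e₁.arrowCongr (1 : F ≃L[ℝ] F)).trans
    (ContinuousLinearEquiv.piRing (Fin (Module.finrank ℝ E)))
  rw [← Function.id_comp f, ← e₂.symm_comp_self]
  exact e₂.symm.contDiff.contDiffAt.comp x (contDiffAt_pi.2 fun i ↦ h _)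

theorem contDiffAt_chartEndo (hJ : IsAlmostComplex J) (p : M) :
    ContDiffAt ℝ ∞ (chartEndo J p) (extChartAt 𝓘(ℝ, E) p p) :=
  contDiffAt_of_comp_extChartAt (mem_chart_source E p)
    ((contMDiffAt_hom_bundle _).1 (hJ.smooth p)).2

theorem contMDiffAt_form_apply (hg : IsNordenMetric J g) {Y Z : Π x : M, TangentSpace 𝓘(ℝ, E) x}
    (hY : SmoothFieldAt 𝓘(ℝ, E) Y q) (hZ : SmoothFieldAt 𝓘(ℝ, E) Z q) :
    ContMDiffAt 𝓘(ℝ, E) 𝓘(ℝ, ℝ) ∞ (fun x ↦ g x (Y x) (Z x)) q := by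
  have : ContMDiffAt 𝓘(ℝ, E) (𝓘(ℝ, E).prod 𝓘(ℝ, ℝ)) ∞
      (fun x ↦ TotalSpace.mk' ℝ (E := Bundle.Trivial M ℝ) x (g x (Y x) (Z x))) q :=
    ContMDiffAt.clm_bundle_apply₂ (F₁ := E) (F₂ := E) (hg.smooth q) hY hZ
  simp only [contMDiffAt_totalSpace] at this
  exact this.2

theorem contDiffAt_chartForm [FiniteDimensional ℝ E] (hg : IsNordenMetric J g) (p : M) :
    ContDiffAt ℝ ∞ (chartForm g p) (extChartAt 𝓘(ℝ, E) p p) := by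
  have hp := mem_chart_source E p
  refine contDiffAt_clm_of_apply fun a ↦ contDiffAt_clm_of_apply fun b ↦ ?_
  refine contDiffAt_of_comp_extChartAt (f := fun q ↦ formAt g p q a b) hp ?_
  exact contMDiffAt_form_apply hg (smoothFieldAt_chartField hp a) (smoothFieldAt_chartField hp b)

variable [FiniteDimensional ℝ E]
  {cov : CovariantDerivative 𝓘(ℝ, E) E (TangentSpace 𝓘(ℝ, E) : M → Type _)}

theorem contDiffAt_christoffel [T2Space M] (hcov : cov.ContMDiffCovariantDerivative ∞) (p : M) :
    ContDiffAt ℝ ∞ (christoffel cov p) (extChartAt 𝓘(ℝ, E) p p) := by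
  have hp := mem_chart_source E p
  have key : ∀ i, ContMDiffAt 𝓘(ℝ, E) 𝓘(ℝ, E →L[ℝ] E) ∞ (covCoordField cov p i) p := fun i ↦ by
    -- Smoothness of `cov` is applied to a globally smooth field, whereas a coordinate field is
    -- smooth only on the chart domain. It is cut off by `ψ`; by locality the covariant derivative
    -- is unchanged where `ψ` is 1 in a neighbourhood.
    let ψ : SmoothBumpFunction 𝓘(ℝ, E) p := Classical.arbitrary _
    set Y : Π x : M, TangentSpace 𝓘(ℝ, E) x := chartField p fun _ ↦ Module.finBasis ℝ E i with hY
    have hYs : ContMDiffOn 𝓘(ℝ, E) 𝓘(ℝ, E).tangent ∞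
        (fun x ↦ (⟨x, Y x⟩ : TangentBundle 𝓘(ℝ, E) M)) (chartAt E p).source :=
      fun q hq ↦ (smoothFieldAt_chartField hq _).contMDiffWithinAt
    have hZ : ContMDiff 𝓘(ℝ, E) 𝓘(ℝ, E).tangent ∞
        (fun x ↦ (⟨x, ((ψ : M → ℝ) • Y) x⟩ : TangentBundle 𝓘(ℝ, E) M)) :=
      ContMDiffOn.smul_section_of_tsupport ψ.contMDiff.contMDiffOn (chartAt E p).open_source
        ψ.tsupport_subset_chartAt_source hYs
    have h1 := hcov.contMDiff.contMDiff (σ := (ψ : M → ℝ) • Y) hZ.contMDiffOn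
    have h2 := ((contMDiffAt_hom_bundle _).1 (h1.contMDiffAt (x := p) Filter.univ_mem)).2
    refine h2.congr_of_eventuallyEq ?_
    filter_upwards [ψ.eventuallyEq_one.eventually_nhds, eventually_mem_chart_source hp] with x hx hxp
    have hc : cov Y x = cov ((ψ : M → ℝ) • Y) x := by
      refine cov.isCovariantDerivativeOnUniv.congr_of_eventuallyEq
        (smoothFieldAt_chartField hxp _).mdifferentiableAt
        ((hZ x).mdifferentiableAt (by simp)) Filter.univ_mem ?_
      filter_upwards [hx] with y hy
      simp [hy]
    simp only [covCoordField, ← hY, hc]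
    rfl
  have h2 : ContMDiffAt 𝓘(ℝ, E) 𝓘(ℝ, E →L[ℝ] E →L[ℝ] E) ∞ (christoffelAt cov p) p := by
    have := ContMDiffAt.sum (t := Finset.univ) fun i _ ↦
      (((ContinuousLinearMap.smulRightL ℝ E (E →L[ℝ] E)
        (LinearMap.toContinuousLinearMap ((Module.finBasis ℝ E).coord i))).contDiff).contMDiff
        (n := ∞)).contMDiffAt.comp p (key i)
    refine this.congr_of_eventuallyEq (.of_forall fun x ↦ ?_)
    simp only [christoffelAt, Function.comp]
    rfl
  exact contDiffAt_of_comp_extChartAt hp h2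

/-- Vanishing torsion, evaluated on commuting coordinate fields. -/
theorem christoffelAt_symm [IsManifold 𝓘(ℝ, E) 2 M] (hcov : cov.torsion = 0)
    (hq : q ∈ (chartAt E p).source) (a b : E) :
    christoffelAt cov p q a b = christoffelAt cov p q b a := by
  have h := (cov.torsion_eq_zero_iff.1 hcov) (smoothFieldAt_chartField hq a).mdifferentiableAt
    (smoothFieldAt_chartField hq b).mdifferentiableAt
  rw [mlieBracket_chartField_const hq, sub_eq_zero] at h
  have h2 := congrArg (chartCoord p q) h
  rw [chartCoord_cov cov hq (smoothFieldAt_chartField hq b).mdifferentiableAt,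
    chartCoord_cov cov hq (smoothFieldAt_chartField hq a).mdifferentiableAt,
    (fieldCoord_chartField hq _).fderiv_eq, (fieldCoord_chartField hq _).fderiv_eq] at h2
  simp only [chartField, chartCoord_chartFrame hq] at h2
  simpa using h2.symm

theorem chartForm_metric (hcov : IsLeviCivita g cov)
    (hq : q ∈ (chartAt E p).source)
    (hd : DifferentiableAt ℝ (chartForm g p) (extChartAt 𝓘(ℝ, E) p q)) (v a b : E) :
    fderiv ℝ (chartForm g p) (extChartAt 𝓘(ℝ, E) p q) v a b =
      formAt g p q (christoffelAt cov p q a v) b + formAt g p q a (christoffelAt cov p q b v) := by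
  have h := hcov.metric q (chartFrame p q v) _ _ (smoothFieldAt_chartField hq a)
    (smoothFieldAt_chartField hq b)
  have hc : ∀ a, cov (chartField p fun _ ↦ a) q (chartFrame p q v) =
      chartFrame p q (christoffelAt cov p q a v) := fun a ↦ by
    apply chartCoord_injective hq
    rw [chartCoord_cov cov hq (smoothFieldAt_chartField hq a).mdifferentiableAt,
      (fieldCoord_chartField hq _).fderiv_eq]
    simp [chartField, chartCoord_chartFrame hq]
  rw [hc, hc] at h
  have he : (fun y ↦ g y (chartField p (fun _ ↦ a) y) (chartField p (fun _ ↦ b) y)) =ᶠ[𝓝 q]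
      fun y ↦ chartForm g p (extChartAt 𝓘(ℝ, E) p y) a b := by
    filter_upwards [eventually_mem_chart_source hq] with y hy
    rw [chartForm_extChartAt hy]
    rfl
  have hd1 : HasFDerivAt (fun e ↦ chartForm g p e a b)
      (((fderiv ℝ (chartForm g p) (extChartAt 𝓘(ℝ, E) p q)).flip a).flip b)
      (extChartAt 𝓘(ℝ, E) p q) := by
    have := (hd.hasFDerivAt.clm_apply (hasFDerivAt_const a _)).clm_apply (hasFDerivAt_const b _)
    exact this.congr_fderiv (by ext; simp)
  have h3 := mfderiv_comp_extChartAt hq hd1.differentiableAt (chartFrame p q v)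
  rw [← he.mfderiv_eq, hd1.fderiv, chartCoord_chartFrame hq] at h3
  exact h3.symm.trans h

theorem isLocalNorden [T2Space M] (hJ : IsAlmostComplex J) (hg : IsNordenMetric J g)
    (hcov : IsLeviCivita g cov) (p : M) :
    IsLocalNorden (chartEndo J p) (chartForm g p) (christoffel cov p)
      (extChartAt 𝓘(ℝ, E) p p) := by
  have hp := mem_chart_source E p
  have hsrc := eventually_mem_chart_source hp
  have two : (2 : WithTop ℕ∞) ≤ ∞ := WithTop.coe_le_coe.2 (le_top : (2 : ℕ∞) ≤ ⊤)
  have one : (1 : WithTop ℕ∞) ≤ ∞ := WithTop.coe_le_coe.2 (le_top : (1 : ℕ∞) ≤ ⊤)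
  have cg := (contDiffAt_chartForm hg p).of_le two
  refine ⟨(contDiffAt_chartEndo hJ p).of_le two, cg,
    (contDiffAt_christoffel hcov.smooth p).of_le one, ?_, ?_, ?_, ?_, ?_, ?_⟩
  · refine eventually_extChartAt_of_eventually hp (hsrc.mono fun q hq a ↦ ?_)
    rw [chartEndo_extChartAt hq]
    change endoAt J p q (chartCoord p q (J q (chartFrame p q a))) = _
    rw [endoAt_chartCoord hq, hJ.sq, map_neg, chartCoord_chartFrame hq]
  · refine eventually_extChartAt_of_eventually hp (hsrc.mono fun q hq a b ↦ ?_)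
    rw [chartForm_extChartAt hq, formAt_apply, formAt_apply, hg.symm]
  · intro a ha
    rw [chartForm_extChartAt hp] at ha
    have : chartFrame p p a = 0 := hg.nondegenerate p _ fun w ↦ by
      have := ha (chartCoord p p w)
      rwa [formAt_apply, chartFrame_chartCoord hp] at this
    rw [← chartCoord_chartFrame hp a, this, map_zero]
  · refine eventually_extChartAt_of_eventually hp (hsrc.mono fun q hq a b ↦ ?_)
    rw [chartForm_extChartAt hq, chartEndo_extChartAt hq, formAt_apply, formAt_apply, endoAt_apply,
      endoAt_apply, chartFrame_chartCoord hq, chartFrame_chartCoord hq, hg.norden]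
  · refine eventually_extChartAt_of_eventually hp (hsrc.mono fun q hq a b ↦ ?_)
    rw [christoffel_extChartAt cov hq, christoffelAt_symm hcov.torsion_free hq]
  · have hd : ∀ᶠ e in 𝓝 (extChartAt 𝓘(ℝ, E) p p), DifferentiableAt ℝ (chartForm g p) e :=
      (cg.eventually (by simp)).mono fun e he ↦ he.differentiableAt two_ne_zero
    have hd' := (continuousAt_extChartAt (I := 𝓘(ℝ, E)) p).eventually hd
    refine eventually_extChartAt_of_eventually hp ?_
    filter_upwards [hsrc, hd'] with q hq hdq v a b
    rw [chartForm_metric hcov hq hdq, chartForm_extChartAt hq, christoffel_extChartAt cov hq]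

end LocalGeometry

/-! ### Curvature and parallelism in a chart -/

section Curvature

set_option linter.unusedSectionVars false

variable {E : Type*} [NormedAddCommGroup E] [NormedSpace ℝ E] [FiniteDimensional ℝ E]
  {M : Type*} [TopologicalSpace M] [ChartedSpace E M] [IsManifold 𝓘(ℝ, E) ∞ M]
  {cov : CovariantDerivative 𝓘(ℝ, E) E (TangentSpace 𝓘(ℝ, E) : M → Type _)}
  {J : Π x : M, TangentSpace 𝓘(ℝ, E) x →L[ℝ] TangentSpace 𝓘(ℝ, E) x}
  {X Y Z : Π x : M, TangentSpace 𝓘(ℝ, E) x} {p q : M}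

theorem SmoothFieldAt.eventually_differentiableAt (hq : q ∈ (chartAt E p).source)
    (hY : SmoothFieldAt 𝓘(ℝ, E) Y q) :
    ∀ᶠ x in 𝓝 q, DifferentiableAt ℝ (fieldCoord p Y) (extChartAt 𝓘(ℝ, E) p x) := by
  have h1 : ContDiffAt ℝ 1 (fieldCoord p Y) (extChartAt 𝓘(ℝ, E) p q) :=
    ((smoothFieldAt_iff hq).1 hY).of_le (WithTop.coe_le_coe.2 le_top)
  have h2 : ∀ᶠ e in 𝓝 (extChartAt 𝓘(ℝ, E) p q), DifferentiableAt ℝ (fieldCoord p Y) e :=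
    (h1.eventually (by simp)).mono fun e he ↦ he.differentiableAt one_ne_zero
  exact (continuousAt_extChartAt' (by rwa [extChartAt_source])).eventually h2

theorem fieldCoord_cov (hq : q ∈ (chartAt E p).source) (hZ : SmoothFieldAt 𝓘(ℝ, E) Z q) :
    fieldCoord p (fun y ↦ cov Z y (Y y)) =ᶠ[𝓝 (extChartAt 𝓘(ℝ, E) p q)] fun e ↦
      fderiv ℝ (fieldCoord p Z) e (fieldCoord p Y e)
        + christoffel cov p e (fieldCoord p Z e) (fieldCoord p Y e) := by
  refine eventually_extChartAt_of_eventually hq ?_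
  filter_upwards [eventually_mem_chart_source hq, hZ.eventually_differentiableAt hq] with x hx hdx
  rw [fieldCoord_extChartAt hx, chartCoord_cov cov hx ((mdifferentiableAt_field_iff hx).2 hdx),
    fieldCoord_extChartAt hx, fieldCoord_extChartAt hx, christoffel_extChartAt cov hx]

theorem chartCoord_cov_cov [T2Space M] (hcov : cov.ContMDiffCovariantDerivative ∞)
    (hY : SmoothFieldAt 𝓘(ℝ, E) Y p) (hZ : SmoothFieldAt 𝓘(ℝ, E) Z p)
    (v : TangentSpace 𝓘(ℝ, E) p) {e x y z : E} (he : e = extChartAt 𝓘(ℝ, E) p p)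
    (hx : x = chartCoord p p v) (hy : y = chartCoord p p (Y p)) (hz : z = chartCoord p p (Z p)) :
    chartCoord p p (cov (fun y ↦ cov Z y (Y y)) p v) =
      fderiv ℝ (fderiv ℝ (fieldCoord p Z)) e x y
        + fderiv ℝ (fieldCoord p Z) e (fderiv ℝ (fieldCoord p Y) e x)
        + (fderiv ℝ (christoffel cov p) e x z y
          + christoffel cov p e (fderiv ℝ (fieldCoord p Z) e x) y
          + christoffel cov p e z (fderiv ℝ (fieldCoord p Y) e x))
        + christoffel cov p e (fderiv ℝ (fieldCoord p Z) e y + christoffel cov p e z y) x := by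
  have hp := mem_chart_source E p
  have cZ := (smoothFieldAt_iff hp).1 hZ
  have dY : DifferentiableAt ℝ (fieldCoord p Y) e :=
    he ▸ ((smoothFieldAt_iff hp).1 hY).differentiableAt (by simp)
  have dZ : DifferentiableAt ℝ (fieldCoord p Z) e := he ▸ cZ.differentiableAt (by simp)
  have dDZ : DifferentiableAt ℝ (fderiv ℝ (fieldCoord p Z)) e := by
    rw [he]
    refine ContDiffAt.differentiableAt (n := 1) (cZ.fderiv_right ?_) one_ne_zero
    exact WithTop.coe_le_coe.2 le_top
  have dG : DifferentiableAt ℝ (christoffel cov p) e :=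
    he ▸ (contDiffAt_christoffel hcov p).differentiableAt (by simp)
  have hd := (dDZ.hasFDerivAt.clm_apply dY.hasFDerivAt).add
    ((dG.hasFDerivAt.clm_apply dZ.hasFDerivAt).clm_apply dY.hasFDerivAt)
  have hW := fieldCoord_cov (cov := cov) (Y := Y) hp hZ
  rw [← he] at hW
  have dW := (mdifferentiableAt_field_iff (Y := fun y ↦ cov Z y (Y y)) hp).2
    (by rw [← he]; exact hd.differentiableAt.congr_of_eventuallyEq hW)
  have eY : fieldCoord p Y e = y := by rw [he, fieldCoord_extChartAt hp, hy]
  have eZ : fieldCoord p Z e = z := by rw [he, fieldCoord_extChartAt hp, hz]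
  rw [chartCoord_cov cov hp dW, ← fieldCoord_extChartAt hp (fun y ↦ cov Z y (Y y)), ← he, ← hx,
    hW.eq_of_nhds, hW.fderiv_eq.trans hd.fderiv, ← christoffel_extChartAt cov hp, ← he]
  simp only [add_apply, ContinuousLinearMap.comp_apply, ContinuousLinearMap.flip_apply, eY, eZ]
  abel

/-- The curvature tensor in a chart, at its centre. -/
theorem chartCoord_curvature [T2Space M] (hcov : cov.ContMDiffCovariantDerivative ∞)
    (htor : cov.torsion = 0) (hX : SmoothFieldAt 𝓘(ℝ, E) X p) (hY : SmoothFieldAt 𝓘(ℝ, E) Y p)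
    (hZ : SmoothFieldAt 𝓘(ℝ, E) Z p) :
    chartCoord p p (curvature cov X Y Z p) =
      localCurvature (christoffel cov p) (extChartAt 𝓘(ℝ, E) p p) (chartCoord p p (X p))
        (chartCoord p p (Y p)) (chartCoord p p (Z p)) := by
  have hp := mem_chart_source E p
  have hb := cov.torsion_eq_zero_iff.1 htor hX.mdifferentiableAt hY.mdifferentiableAt
  have hs : IsSymmSndFDerivAt ℝ (fieldCoord p Z) (extChartAt 𝓘(ℝ, E) p p) :=
    ContDiffAt.isSymmSndFDerivAt ((smoothFieldAt_iff hp).1 hZ) (by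
      rw [minSmoothness_of_isRCLikeNormedField]
      exact WithTop.coe_le_coe.2 (le_top : (2 : ℕ∞) ≤ ⊤))
  have hsymm := fun a b : E ↦ christoffelAt_symm htor hp a b
  rw [← christoffel_extChartAt cov hp] at hsymm
  -- Torsion-freeness replaces $[X,Y]$ by $\nabla_XY-\nabla_YX$, which avoids a coordinate formula
  -- for the bracket; the second derivatives of $Z$ cancel by symmetry.
  rw [curvature, map_sub, map_sub, ← hb, chartCoord_cov_cov hcov hY hZ _ rfl rfl rfl rfl,
    chartCoord_cov_cov hcov hX hZ _ rfl rfl rfl rfl, chartCoord_cov cov hp hZ.mdifferentiableAt,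
    map_sub, chartCoord_cov cov hp hX.mdifferentiableAt, chartCoord_cov cov hp hY.mdifferentiableAt,
    ← christoffel_extChartAt cov hp, hs.eq (chartCoord p p (X p)),
    hsymm (chartCoord p p (X p)) (chartCoord p p (Y p))]
  simp only [localCurvature, map_add, map_sub, add_apply]
  abel

theorem isFlat_iff [T2Space M] (hcov : cov.ContMDiffCovariantDerivative ∞)
    (htor : cov.torsion = 0) :
    IsFlat cov ↔ ∀ (p : M) (u v w : E),
      localCurvature (christoffel cov p) (extChartAt 𝓘(ℝ, E) p p) u v w = 0 := by
  refine ⟨fun h p u v w ↦ ?_, fun h p X Y Z hX hY hZ ↦ ?_⟩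
  · have hp := mem_chart_source E p
    have hs := fun a ↦ smoothFieldAt_chartField hp a
    have := chartCoord_curvature hcov htor (hs u) (hs v) (hs w)
    simp only [chartField, chartCoord_chartFrame hp] at this
    rw [← this]
    exact (congrArg (chartCoord p p) (h p _ _ _ (hs u) (hs v) (hs w))).trans (map_zero _)
  · apply chartCoord_injective (mem_chart_source E p)
    rw [chartCoord_curvature hcov htor hX hY hZ, h, map_zero]

/-- The covariant derivative of a field of endomorphisms in a chart. -/
theorem chartCoord_covJ (hq : q ∈ (chartAt E p).source)
    (hJ : DifferentiableAt ℝ (chartEndo J p) (extChartAt 𝓘(ℝ, E) p q))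
    (hY : SmoothFieldAt 𝓘(ℝ, E) Y q) (v : TangentSpace 𝓘(ℝ, E) q) :
    chartCoord p q (cov (fun y ↦ J y (Y y)) q v - J q (cov Y q v)) =
      localCovJ (chartEndo J p) (christoffel cov p) (extChartAt 𝓘(ℝ, E) p q)
        (chartCoord p q v) (chartCoord p q (Y q)) := by
  have dY := (mdifferentiableAt_field_iff hq).1 hY.mdifferentiableAt
  have hd := hJ.hasFDerivAt.clm_apply dY.hasFDerivAt
  have hW : fieldCoord p (fun y ↦ J y (Y y)) =ᶠ[𝓝 (extChartAt 𝓘(ℝ, E) p q)] fun e ↦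
      chartEndo J p e (fieldCoord p Y e) := by
    refine eventually_extChartAt_of_eventually hq ?_
    filter_upwards [eventually_mem_chart_source hq] with x hx
    rw [fieldCoord_extChartAt hx, fieldCoord_extChartAt hx, chartEndo_extChartAt hx,
      endoAt_chartCoord hx]
  have dW := (mdifferentiableAt_field_iff (Y := fun y ↦ J y (Y y)) hq).2
    (hd.differentiableAt.congr_of_eventuallyEq hW)
  rw [map_sub, chartCoord_cov cov hq dW, ← endoAt_chartCoord hq (cov Y q v),
    chartCoord_cov cov hq hY.mdifferentiableAt, ← fieldCoord_extChartAt hq (fun y ↦ J y (Y y)),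
    hW.fderiv_eq.trans hd.fderiv, hW.eq_of_nhds]
  simp only [localCovJ, ← christoffel_extChartAt cov hq, ← chartEndo_extChartAt hq,
    fieldCoord_extChartAt hq, add_apply, ContinuousLinearMap.comp_apply,
    ContinuousLinearMap.flip_apply, map_add]
  abel

/-- Parallelism at all points near `p` is read in the single chart at `p`; this supplies the
neighbourhood that `curvature_J` differentiates over. -/
theorem IsParallel.eventually_localCovJ (hJ : IsAlmostComplex J) (h : IsParallel cov J) (p : M) :
    ∀ᶠ e in 𝓝 (extChartAt 𝓘(ℝ, E) p p), ∀ v a : E,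
      localCovJ (chartEndo J p) (christoffel cov p) e v a = 0 := by
  have hp := mem_chart_source E p
  have h1 : ContDiffAt ℝ 1 (chartEndo J p) (extChartAt 𝓘(ℝ, E) p p) :=
    (contDiffAt_chartEndo hJ p).of_le (WithTop.coe_le_coe.2 le_top)
  have h2 : ∀ᶠ e in 𝓝 (extChartAt 𝓘(ℝ, E) p p), DifferentiableAt ℝ (chartEndo J p) e :=
    (h1.eventually (by simp)).mono fun e he ↦ he.differentiableAt one_ne_zero
  refine eventually_extChartAt_of_eventually hp ?_
  filter_upwards [eventually_mem_chart_source hp,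
    (continuousAt_extChartAt (I := 𝓘(ℝ, E)) p).eventually h2] with q hq hdq v a
  have hs := smoothFieldAt_chartField hq a
  have := chartCoord_covJ (cov := cov) hq hdq hs (chartFrame p q v)
  rw [h q _ _ hs, map_zero] at this
  simp only [chartField, chartCoord_chartFrame hq] at this
  exact this.symm

theorem isParallel_of_localCovJ (hJ : IsAlmostComplex J) (h : ∀ (p : M) (v a : E),
      localCovJ (chartEndo J p) (christoffel cov p) (extChartAt 𝓘(ℝ, E) p p) v a = 0) :
    IsParallel cov J := fun p v Y hY ↦ by
  apply chartCoord_injective (mem_chart_source E p)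
  rw [chartCoord_covJ (mem_chart_source E p)
    ((contDiffAt_chartEndo hJ p).differentiableAt (by simp)) hY, h, map_zero]

end Curvature

/-! ### The Nijenhuis tensor in a chart -/

section Push

set_option linter.unusedSectionVars false

variable {F : Type*} [NormedAddCommGroup F] [NormedSpace ℝ F] [CompleteSpace F]
  {H : Type*} [TopologicalSpace H] (I : ModelWithCorners ℝ F H) [I.Boundaryless]
  {N : Type*} [TopologicalSpace N] [ChartedSpace H N] [IsManifold I 1 N] [IsManifold I 2 N]

/-- The differential at `u` of the extended chart at `u₀`. -/
def chartDeriv (u₀ u : N) : TangentSpace I u →L[ℝ] F :=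
  mfderiv I 𝓘(ℝ, F) (extChartAt I u₀) u

/-- A vector field in the chart at `u₀`. -/
def pushField (u₀ : N) (X : Π u : N, TangentSpace I u) (z : F) : F :=
  chartDeriv I u₀ ((extChartAt I u₀).symm z) (X ((extChartAt I u₀).symm z))

variable {I} {u₀ u : N} {X Y : Π u : N, TangentSpace I u}

theorem isInvertible_chartDeriv (hu : u ∈ (extChartAt I u₀).source) :
    (chartDeriv I u₀ u).IsInvertible :=
  isInvertible_mfderiv_extChartAt hu

theorem pushField_extChartAt (hu : u ∈ (extChartAt I u₀).source) (X : Π u : N, TangentSpace I u) :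
    pushField I u₀ X (extChartAt I u₀ u) = chartDeriv I u₀ u (X u) := by
  have : ∀ u', u' = u → chartDeriv I u₀ u' (X u') = chartDeriv I u₀ u (X u) := fun u' h ↦ by rw [h]
  exact this _ ((extChartAt I u₀).left_inv hu)

theorem eventually_extChartAt_symm {P : N → Prop}
    (h : ∀ᶠ u in 𝓝 u₀, P u) : ∀ᶠ z in 𝓝 (extChartAt I u₀ u₀), P ((extChartAt I u₀).symm z) := by
  have := continuousAt_extChartAt_symm (I := I) u₀
  rw [ContinuousAt, extChartAt_to_inv] at this
  exact this.eventually h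

theorem pushField_map (A : Π u : N, TangentSpace I u →ₗ[ℝ] TangentSpace I u) {B : F → F →L[ℝ] F}
    (hAB : ∀ u ∈ (extChartAt I u₀).source, ∀ w,
      chartDeriv I u₀ u (A u w) = B (extChartAt I u₀ u) (chartDeriv I u₀ u w)) :
    pushField I u₀ (fun u ↦ A u (X u)) =ᶠ[𝓝 (extChartAt I u₀ u₀)]
      fun z ↦ B z (pushField I u₀ X z) := by
  filter_upwards [extChartAt_target_mem_nhds (I := I) u₀] with z hz
  rw [pushField, hAB _ ((extChartAt I u₀).map_target hz), (extChartAt I u₀).right_inv hz, pushField]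

theorem SmoothFieldAt.differentiableAt_pushField (hX : SmoothFieldAt I X u₀) :
    DifferentiableAt ℝ (pushField I u₀ X) (extChartAt I u₀ u₀) := by
  have hu := mem_chart_source H u₀
  have h1 : MDifferentiableAt I 𝓘(ℝ, F)
      (fun u ↦ (trivializationAt F (TangentSpace I) u₀ ⟨u, X u⟩).2) u₀ :=
    ((trivializationAt F (TangentSpace I) u₀).mdifferentiableAt_section_iff I X hu).1
      (ContMDiffAt.mdifferentiableAt hX (by simp))
  have hs : ContMDiffAt 𝓘(ℝ, F) I 1 (extChartAt I u₀).symm (extChartAt I u₀ u₀) :=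
    (contMDiffOn_extChartAt_symm u₀).contMDiffAt (extChartAt_target_mem_nhds u₀)
  rw [← extChartAt_to_inv (I := I) u₀] at h1
  refine (h1.comp _ (hs.mdifferentiableAt (by simp))).differentiableAt.congr_of_eventuallyEq ?_
  filter_upwards [eventually_extChartAt_symm ((chartAt H u₀).open_source.mem_nhds hu)] with z hz
  simp only [Function.comp]
  rw [pushField, chartDeriv, ← TangentBundle.continuousLinearMapAt_trivializationAt hz,
    extChartAt_to_inv]
  exact (trivializationAt F (TangentSpace I) u₀).continuousLinearMapAt_apply_of_mem (R := ℝ) hz _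

theorem eventuallyEq_mpullback_pushField :
    X =ᶠ[𝓝 u₀] mpullback I 𝓘(ℝ, F) (extChartAt I u₀) (pushField I u₀ X) := by
  filter_upwards [extChartAt_source_mem_nhds (I := I) u₀] with u hu
  have h := pushField_extChartAt hu X
  change _ = (mfderiv I 𝓘(ℝ, F) (extChartAt I u₀) u).inverse _
  refine Eq.symm (Eq.trans (congrArg _ h) ?_)
  exact ((isInvertible_chartDeriv hu).inverse_apply_eq.2 rfl)

/-- Naturality of the Lie bracket: near `u₀` each field is the pullback by the chart of its
coordinate expression. -/
theorem chartDeriv_mlieBracket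
    (hX : DifferentiableAt ℝ (pushField I u₀ X) (extChartAt I u₀ u₀))
    (hY : DifferentiableAt ℝ (pushField I u₀ Y) (extChartAt I u₀ u₀)) :
    chartDeriv I u₀ u₀ (mlieBracket I X Y u₀) =
      lieBracket ℝ (pushField I u₀ X) (pushField I u₀ Y) (extChartAt I u₀ u₀) := by
  have hd : ∀ {V : F → F} {z : F}, DifferentiableAt ℝ V z → MDifferentiableAt 𝓘(ℝ, F) 𝓘(ℝ, F).tangent
      (fun x ↦ (⟨x, V x⟩ : TangentBundle 𝓘(ℝ, F) F)) z := fun {V z} hV ↦ by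
    refine (mdifferentiableAt_totalSpace _ _).2 ⟨mdifferentiableAt_id, ?_⟩
    simpa using hV.mdifferentiableAt
  have hN : IsManifold I (minSmoothness ℝ 2) N := by
    rw [minSmoothness_of_isRCLikeNormedField]; infer_instance
  have hF : IsManifold 𝓘(ℝ, F) (minSmoothness ℝ 2) F := by
    rw [minSmoothness_of_isRCLikeNormedField]; infer_instance
  have hφ : ContMDiffAt I 𝓘(ℝ, F) 2 (extChartAt I u₀) u₀ := contMDiffAt_extChartAt
  rw [(eventuallyEq_mpullback_pushField (X := X)).mlieBracket_vectorField_eq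
    (eventuallyEq_mpullback_pushField (X := Y)), ← mpullback_mlieBracket (hd hX) (hd hY) hφ
    (by rw [minSmoothness_of_isRCLikeNormedField]), mpullback_apply]
  refine ((isInvertible_chartDeriv (mem_extChartAt_source u₀)).inverse_apply_eq.1 rfl).symm.trans ?_
  have h := mlieBracketWithin_eq_lieBracketWithin (𝕜 := ℝ) (V := pushField I u₀ X) (W := pushField I u₀ Y)
    (s := Set.univ)
  rw [lieBracketWithin_univ] at h
  exact congrFun h _

theorem chartDeriv_nijenhuis
    (A : Π u : N, TangentSpace I u →ₗ[ℝ] TangentSpace I u) {B : F → F →L[ℝ] F}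
    (hAB : ∀ u ∈ (extChartAt I u₀).source, ∀ w,
      chartDeriv I u₀ u (A u w) = B (extChartAt I u₀ u) (chartDeriv I u₀ u w))
    (hB : DifferentiableAt ℝ B (extChartAt I u₀ u₀))
    (hX : SmoothFieldAt I X u₀) (hY : SmoothFieldAt I Y u₀) :
    chartDeriv I u₀ u₀ (nijenhuis I A X Y u₀) =
      vectorSpaceNijenhuis B (pushField I u₀ X) (pushField I u₀ Y) (extChartAt I u₀ u₀) := by
  have dX := hX.differentiableAt_pushField
  have dY := hY.differentiableAt_pushField
  have eX := pushField_map (X := X) A hAB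
  have eY := pushField_map (X := Y) A hAB
  have dAX := (hB.clm_apply dX).congr_of_eventuallyEq eX
  have dAY := (hB.clm_apply dY).congr_of_eventuallyEq eY
  have hu := mem_extChartAt_source (I := I) u₀
  rw [nijenhuis, map_sub, map_add, map_add, hAB _ hu, hAB _ hu, chartDeriv_mlieBracket dX dY,
    chartDeriv_mlieBracket dAX dY, chartDeriv_mlieBracket dX dAY, chartDeriv_mlieBracket dAX dAY,
    eX.lieBracket_vectorField_eq .rfl, eX.lieBracket_vectorField_eq eY,
    Filter.EventuallyEq.rfl.lieBracket_vectorField_eq eY]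
  rfl

/-- Supplies enough smooth fields to test a tensor on arbitrary vectors at `u₀`. -/
theorem exists_smoothFieldAt (a : F) :
    ∃ X : Π u : N, TangentSpace I u, SmoothFieldAt I X u₀ ∧ chartDeriv I u₀ u₀ (X u₀) = a := by
  obtain ⟨e, he⟩ := isInvertible_chartDeriv (mem_extChartAt_source (I := I) u₀)
  refine ⟨FiberBundle.extend F (e.symm a), ?_, ?_⟩
  · exact FiberBundle.contMDiffAt_extend I F _
  · rw [FiberBundle.extend_apply_self, ← he]
    exact e.apply_symm_apply a

end Push

/-! ### The lifts in a chart of the tangent bundle -/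

section TangentChart

set_option linter.unusedSectionVars false

variable {E : Type*} [NormedAddCommGroup E] [NormedSpace ℝ E]
  {M : Type*} [TopologicalSpace M] [ChartedSpace E M] [IsManifold 𝓘(ℝ, E) ∞ M]
  {u₀ u : TangentBundle 𝓘(ℝ, E) M}

theorem mem_extChartAt_tangent_source :
    u ∈ (extChartAt 𝓘(ℝ, E).tangent u₀).source ↔ u.proj ∈ (chartAt E u₀.proj).source := by
  rw [extChartAt_source, TangentBundle.mem_chart_source_iff]

theorem extChartAt_tangent_apply (hu : u.proj ∈ (chartAt E u₀.proj).source) :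
    extChartAt 𝓘(ℝ, E).tangent u₀ u =
      (extChartAt 𝓘(ℝ, E) u₀.proj u.proj, chartCoord u₀.proj u.proj u.2) := by
  rw [ModelWithCorners.tangent, FiberBundle.extChartAt]
  have h := (trivializationAt E (TangentSpace 𝓘(ℝ, E)) u₀.proj).continuousLinearMapAt_apply_of_mem
    (R := ℝ) hu u.2
  have h2 := (trivializationAt E (TangentSpace 𝓘(ℝ, E)) u₀.proj).coe_fst' hu
  ext
  · exact congrArg (extChartAt 𝓘(ℝ, E) u₀.proj) h2
  · exact h.symm

theorem mdifferentiableAt_extChartAt_tangent (hu : u.proj ∈ (chartAt E u₀.proj).source) :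
    MDifferentiableAt 𝓘(ℝ, E).tangent 𝓘(ℝ, E × E) (extChartAt 𝓘(ℝ, E).tangent u₀) u :=
  mdifferentiableAt_extChartAt ((TangentBundle.mem_chart_source_iff _ _).2 hu)

theorem chartDeriv_verticalLift (hu : u.proj ∈ (chartAt E u₀.proj).source)
    (v : TangentSpace 𝓘(ℝ, E) u.proj) :
    chartDeriv 𝓘(ℝ, E).tangent u₀ u (verticalLift u v) = (0, chartCoord u₀.proj u.proj v) := by
  let y : E := u.2
  have hy : MDifferentiableAt 𝓘(ℝ, E) 𝓘(ℝ, E).tangent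
    (fun v : E ↦ (⟨u.proj, v⟩ : TangentBundle 𝓘(ℝ, E) M)) y := mdifferentiableAt_fibreInclusion _ _
  have h := mfderiv_comp_apply (I'' := 𝓘(ℝ, E × E)) y
    (mdifferentiableAt_extChartAt_tangent (u := u) hu) hy v
  refine h.symm.trans ?_
  let L : E →L[ℝ] E := chartCoord u₀.proj u.proj
  have hc : extChartAt 𝓘(ℝ, E).tangent u₀ ∘
      (fun v : E ↦ (⟨u.proj, v⟩ : TangentBundle 𝓘(ℝ, E) M)) =
      fun v ↦ (extChartAt 𝓘(ℝ, E) u₀.proj u.proj, L v) :=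
    funext fun v ↦ extChartAt_tangent_apply (u := ⟨u.proj, v⟩) hu
  have hd : HasFDerivAt (fun v : E ↦ (extChartAt 𝓘(ℝ, E) u₀.proj u.proj, L v))
      ((0 : E →L[ℝ] E).prod L) y :=
    (hasFDerivAt_const _ _).prodMk L.hasFDerivAt
  rw [hc]
  exact congr($(mfderiv_eq_fderiv.trans hd.fderiv) v)

/-- In the induced chart a vector field is the graph $e\mapsto(e,Y(e))$ of its components. -/
theorem chartDeriv_mfderiv_section (hu : u.proj ∈ (chartAt E u₀.proj).source)
    {Y : Π x : M, TangentSpace 𝓘(ℝ, E) x} (hY : SmoothFieldAt 𝓘(ℝ, E) Y u.proj)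
    (hYu : Y u.proj = u.2) (v : TangentSpace 𝓘(ℝ, E) u.proj) :
    chartDeriv 𝓘(ℝ, E).tangent u₀ u
        ((mfderiv 𝓘(ℝ, E) 𝓘(ℝ, E).tangent (fun x ↦ (⟨x, Y x⟩ : TangentBundle 𝓘(ℝ, E) M)) u.proj :
          TangentSpace 𝓘(ℝ, E) u.proj →L[ℝ] TangentSpace 𝓘(ℝ, E).tangent u) v) =
      (chartCoord u₀.proj u.proj v, fderiv ℝ (fieldCoord u₀.proj Y)
        (extChartAt 𝓘(ℝ, E) u₀.proj u.proj) (chartCoord u₀.proj u.proj v)) := by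
  obtain ⟨q, y⟩ := u
  obtain rfl : Y q = y := hYu
  have h := mfderiv_comp_apply (I := 𝓘(ℝ, E)) (I' := 𝓘(ℝ, E).tangent) (I'' := 𝓘(ℝ, E × E))
    (f := fun x ↦ (⟨x, Y x⟩ : TangentBundle 𝓘(ℝ, E) M)) q
    (mdifferentiableAt_extChartAt_tangent hu) hY.mdifferentiableAt v
  refine h.symm.trans ?_
  have hc : extChartAt 𝓘(ℝ, E).tangent u₀ ∘ (fun x ↦ (⟨x, Y x⟩ : TangentBundle 𝓘(ℝ, E) M)) =ᶠ[𝓝 q]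
      fun x ↦ (fun e ↦ (e, fieldCoord u₀.proj Y e)) (extChartAt 𝓘(ℝ, E) u₀.proj x) := by
    filter_upwards [eventually_mem_chart_source hu] with x hx
    simp only [Function.comp]
    rw [extChartAt_tangent_apply (u := ⟨x, Y x⟩) hx, fieldCoord_extChartAt hx]
  have hd := (hasFDerivAt_id (𝕜 := ℝ) (extChartAt 𝓘(ℝ, E) u₀.proj q)).prodMk
    ((mdifferentiableAt_field_iff hu).1 hY.mdifferentiableAt).hasFDerivAt
  have h2 := mfderiv_comp_extChartAt hu hd.differentiableAt v
  rw [hd.fderiv] at h2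
  rw [hc.mfderiv_eq]
  exact h2

variable [FiniteDimensional ℝ E]
  {cov : CovariantDerivative 𝓘(ℝ, E) E (TangentSpace 𝓘(ℝ, E) : M → Type _)}

/-- The derivative of the auxiliary extension occurs both in $dY(v)$ and in $\nabla_vY$ and cancels;
only the Christoffel term remains, so the lift does not depend on the extension. -/
theorem chartDeriv_horizontalLift (hu : u.proj ∈ (chartAt E u₀.proj).source)
    (v : TangentSpace 𝓘(ℝ, E) u.proj) :
    chartDeriv 𝓘(ℝ, E).tangent u₀ u (horizontalLift cov u v) =
      (chartCoord u₀.proj u.proj v, -christoffelAt cov u₀.proj u.proj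
        (chartCoord u₀.proj u.proj u.2) (chartCoord u₀.proj u.proj v)) := by
  have hY : SmoothFieldAt 𝓘(ℝ, E) (FiberBundle.extend E u.2) u.proj :=
    FiberBundle.contMDiffAt_extend 𝓘(ℝ, E) E _
  have h1 := chartDeriv_mfderiv_section hu hY (FiberBundle.extend_apply_self E u.2) v
  have h2 := chartDeriv_verticalLift hu (cov (FiberBundle.extend E u.2) u.proj v)
  rw [chartCoord_cov cov hu hY.mdifferentiableAt, FiberBundle.extend_apply_self] at h2
  refine (map_sub (chartDeriv 𝓘(ℝ, E).tangent u₀ u) _ _).trans ?_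
  refine (congrArg₂ (fun a b : E × E ↦ a - b) h1 h2).trans ?_
  ext <;> simp

theorem chartDeriv_liftEquiv (hu : u.proj ∈ (chartAt E u₀.proj).source)
    (v w : TangentSpace 𝓘(ℝ, E) u.proj) :
    chartDeriv 𝓘(ℝ, E).tangent u₀ u (liftEquiv cov u (v, w)) =
      liftFrame (christoffel cov u₀.proj) (extChartAt 𝓘(ℝ, E).tangent u₀ u)
        (chartCoord u₀.proj u.proj v, chartCoord u₀.proj u.proj w) := by
  rw [liftEquiv_apply, map_add, chartDeriv_horizontalLift hu, chartDeriv_verticalLift hu,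
    liftFrame_apply, extChartAt_tangent_apply hu, christoffel_extChartAt cov hu]
  ext <;> simp [neg_add_eq_sub]

/-- An endomorphism of `T_u TM` given in terms of horizontal and vertical lifts, in a chart. -/
theorem chartDeriv_conj (hu : u.proj ∈ (chartAt E u₀.proj).source)
    {B : TangentSpace 𝓘(ℝ, E) u.proj × TangentSpace 𝓘(ℝ, E) u.proj →ₗ[ℝ]
      TangentSpace 𝓘(ℝ, E) u.proj × TangentSpace 𝓘(ℝ, E) u.proj} {S : E → E × E →L[ℝ] E × E}
    (hS : ∀ v w, S (extChartAt 𝓘(ℝ, E) u₀.proj u.proj)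
        (chartCoord u₀.proj u.proj v, chartCoord u₀.proj u.proj w) =
      (chartCoord u₀.proj u.proj (B (v, w)).1, chartCoord u₀.proj u.proj (B (v, w)).2))
    (w : TangentSpace 𝓘(ℝ, E).tangent u) :
    chartDeriv 𝓘(ℝ, E).tangent u₀ u ((liftEquiv cov u).conj B w) =
      frameConj (christoffel cov u₀.proj) S (extChartAt 𝓘(ℝ, E).tangent u₀ u)
        (chartDeriv 𝓘(ℝ, E).tangent u₀ u w) := by
  obtain ⟨⟨v, w⟩, rfl⟩ := (liftEquiv cov u).surjective w
  rw [chartDeriv_liftEquiv hu, frameConj_liftFrame, LinearEquiv.conj_apply_apply,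
    LinearEquiv.symm_apply_apply, ← Prod.mk.eta (p := B (v, w)), chartDeriv_liftEquiv hu,
    ← hS, extChartAt_tangent_apply hu]

/-- Integrability on the tangent bundle, in terms of the horizontal-vertical frames of the charts. -/
theorem isComplexStructure_conj_iff [T2Space M] (hcov : cov.ContMDiffCovariantDerivative ∞)
    {B : Π p : M, TangentSpace 𝓘(ℝ, E) p × TangentSpace 𝓘(ℝ, E) p →ₗ[ℝ]
      TangentSpace 𝓘(ℝ, E) p × TangentSpace 𝓘(ℝ, E) p} {S : M → E → E × E →L[ℝ] E × E}
    (hS : ∀ p q, q ∈ (chartAt E p).source → ∀ v w, S p (extChartAt 𝓘(ℝ, E) p q)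
        (chartCoord p q v, chartCoord p q w) =
      (chartCoord p q (B q (v, w)).1, chartCoord p q (B q (v, w)).2))
    (hd : ∀ p, DifferentiableAt ℝ (S p) (extChartAt 𝓘(ℝ, E) p p))
    (hsq : ∀ p a, S p (extChartAt 𝓘(ℝ, E) p p) (S p (extChartAt 𝓘(ℝ, E) p p) a) = -a) :
    IsComplexStructure 𝓘(ℝ, E).tangent (fun u ↦ (liftEquiv cov u).conj (B u.proj)) ↔
      ∀ p y a b, frameNijenhuis (christoffel cov p) (S p) (extChartAt 𝓘(ℝ, E) p p) y a b = 0 := by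
  have key : ∀ (u : TangentBundle 𝓘(ℝ, E) M) (X Y : Π u, TangentSpace 𝓘(ℝ, E).tangent u),
      SmoothFieldAt 𝓘(ℝ, E).tangent X u → SmoothFieldAt 𝓘(ℝ, E).tangent Y u →
      (nijenhuis 𝓘(ℝ, E).tangent (fun u ↦ (liftEquiv cov u).conj (B u.proj)) X Y u = 0 ↔
        frameNijenhuis (christoffel cov u.proj) (S u.proj) (extChartAt 𝓘(ℝ, E) u.proj u.proj)
          (chartCoord u.proj u.proj u.2)
          (liftFrameInv (christoffel cov u.proj) (extChartAt 𝓘(ℝ, E).tangent u u)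
            (chartDeriv 𝓘(ℝ, E).tangent u u (X u)))
          (liftFrameInv (christoffel cov u.proj) (extChartAt 𝓘(ℝ, E).tangent u u)
            (chartDeriv 𝓘(ℝ, E).tangent u u (Y u))) = 0) := fun u X Y hX hY ↦ by
    have hu := mem_chart_source E u.proj
    have hs := mem_extChartAt_source (I := 𝓘(ℝ, E).tangent) u
    have e1 : (extChartAt 𝓘(ℝ, E).tangent u u).1 = extChartAt 𝓘(ℝ, E) u.proj u.proj := by
      rw [extChartAt_tangent_apply hu]
    have e2 : (extChartAt 𝓘(ℝ, E).tangent u u).2 = chartCoord u.proj u.proj u.2 := by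
      rw [extChartAt_tangent_apply hu]
    have dG : DifferentiableAt ℝ (christoffel cov u.proj) (extChartAt 𝓘(ℝ, E).tangent u u).1 := by
      rw [e1]
      exact (contDiffAt_christoffel hcov u.proj).differentiableAt (by simp)
    have dS : DifferentiableAt ℝ (S u.proj) (extChartAt 𝓘(ℝ, E).tangent u u).1 := by
      rw [e1]; exact hd _
    have hN := chartDeriv_nijenhuis (fun u ↦ (liftEquiv cov u).conj (B u.proj))
      (B := frameConj (christoffel cov u.proj) (S u.proj))
      (fun x hx w ↦ chartDeriv_conj (mem_extChartAt_tangent_source.1 hx)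
        (hS _ _ (mem_extChartAt_tangent_source.1 hx)) w) (differentiableAt_frameConj dG dS) hX hY
    have h0 := vectorSpaceNijenhuis_frameConj_eq_zero_iff dG dS (by rw [e1]; exact hsq _)
      hX.differentiableAt_pushField hY.differentiableAt_pushField
    rw [pushField_extChartAt hs, pushField_extChartAt hs, ← hN, e1, e2] at h0
    rw [← h0]
    obtain ⟨e, he⟩ := isInvertible_chartDeriv hs
    rw [← he]
    exact (map_eq_zero_iff e e.injective).symm
  refine ⟨fun h p y a b ↦ ?_, fun h u X Y hX hY ↦ (key u X Y hX hY).2 (h _ _ _ _)⟩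
  -- The point over `p` with fibre coordinate `y`; the fields are then chosen with frame
  -- coefficients `a` and `b` there.
  let u : TangentBundle 𝓘(ℝ, E) M := ⟨p, chartFrame p p y⟩
  have hy : chartCoord p p u.2 = y := chartCoord_chartFrame (mem_chart_source E p) y
  obtain ⟨X, hX, rX⟩ := exists_smoothFieldAt (I := 𝓘(ℝ, E).tangent) (u₀ := u)
    (liftFrame (christoffel cov p) (extChartAt 𝓘(ℝ, E).tangent u u) a)
  obtain ⟨Y, hY, rY⟩ := exists_smoothFieldAt (I := 𝓘(ℝ, E).tangent) (u₀ := u)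
    (liftFrame (christoffel cov p) (extChartAt 𝓘(ℝ, E).tangent u u) b)
  have := (key u X Y hX hY).1 (h u X Y hX hY)
  rwa [rX, rY, liftFrameInv_liftFrame, liftFrameInv_liftFrame, hy] at this

end TangentChart

/-! ### Integrability of the lifted structures in charts -/

section Lifted

set_option linter.unusedSectionVars false

variable {E : Type*} [NormedAddCommGroup E] [NormedSpace ℝ E] [FiniteDimensional ℝ E]
  {M : Type*} [TopologicalSpace M] [T2Space M] [ChartedSpace E M] [IsManifold 𝓘(ℝ, E) ∞ M]
  {J : Π x : M, TangentSpace 𝓘(ℝ, E) x →L[ℝ] TangentSpace 𝓘(ℝ, E) x}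
  {cov : CovariantDerivative 𝓘(ℝ, E) E (TangentSpace 𝓘(ℝ, E) : M → Type _)}

theorem differentiableAt_chartEndo (hJ : IsAlmostComplex J) (p : M) :
    DifferentiableAt ℝ (chartEndo J p) (extChartAt 𝓘(ℝ, E) p p) :=
  (contDiffAt_chartEndo hJ p).differentiableAt (by simp)

theorem chartEndo_sq (hJ : IsAlmostComplex J) (p : M) (a : E) :
    chartEndo J p (extChartAt 𝓘(ℝ, E) p p) (chartEndo J p (extChartAt 𝓘(ℝ, E) p p) a) = -a := by
  have hp := mem_chart_source E p
  rw [chartEndo_extChartAt hp]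
  change endoAt J p p (chartCoord p p (J p (chartFrame p p a))) = _
  rw [endoAt_chartCoord hp, hJ.sq, map_neg, chartCoord_chartFrame hp]

theorem chartEndo_chartCoord {p q : M} (hq : q ∈ (chartAt E p).source)
    (v : TangentSpace 𝓘(ℝ, E) q) :
    chartEndo J p (extChartAt 𝓘(ℝ, E) p q) (chartCoord p q v) = chartCoord p q (J q v) := by
  rw [chartEndo_extChartAt hq, endoAt_chartCoord hq]

theorem isComplexStructure_liftJ₁_iff (hJ : IsAlmostComplex J)
    (hcov : cov.ContMDiffCovariantDerivative ∞) :
    IsComplexStructure 𝓘(ℝ, E).tangent (liftJ₁ cov J) ↔ ∀ p y a b, frameNijenhuis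
      (christoffel cov p) (frameJ₁ (chartEndo J p)) (extChartAt 𝓘(ℝ, E) p p) y a b = 0 := by
  let B : Π p : M, TangentSpace 𝓘(ℝ, E) p × TangentSpace 𝓘(ℝ, E) p →ₗ[ℝ]
      TangentSpace 𝓘(ℝ, E) p × TangentSpace 𝓘(ℝ, E) p := fun q ↦ 
    (-(J q : _ →ₗ[ℝ] _)).prodMap (J q : _ →ₗ[ℝ] _)
  have e : liftJ₁ cov J = fun u ↦ (liftEquiv cov u).conj (B u.proj) := rfl
  rw [e]
  refine isComplexStructure_conj_iff hcov (S := fun p ↦ frameJ₁ (chartEndo J p))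
    (fun p q hq v w ↦ ?_)
    (fun p ↦ differentiableAt_frameJ₁ (differentiableAt_chartEndo hJ p)) fun p a ↦ ?_
  · rw [frameJ₁_apply, chartEndo_chartCoord hq, chartEndo_chartCoord hq, ← map_neg]
    rfl
  · simp only [frameJ₁_apply, map_neg, neg_neg, chartEndo_sq hJ]
    rfl

theorem isComplexStructure_liftJ₂_iff (hcov : cov.ContMDiffCovariantDerivative ∞) :
    IsComplexStructure 𝓘(ℝ, E).tangent (liftJ₂ cov) ↔ ∀ (p : M) y a b, frameNijenhuis
      (christoffel cov p) frameJ₂ (extChartAt 𝓘(ℝ, E) p p) y a b = 0 := by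
  refine isComplexStructure_conj_iff hcov (S := fun _ ↦ frameJ₂)
    (B := fun q ↦ (-LinearMap.snd ℝ _ _).prod (LinearMap.fst ℝ _ _)) (fun p q hq v w ↦ ?_)
    (fun p ↦ differentiableAt_const _) fun p a ↦ ?_
  · rw [frameJ₂_apply, ← map_neg]
    rfl
  · simp
    rfl

theorem isComplexStructure_liftJ₃_iff (hJ : IsAlmostComplex J)
    (hcov : cov.ContMDiffCovariantDerivative ∞) :
    IsComplexStructure 𝓘(ℝ, E).tangent (liftJ₃ cov J) ↔ ∀ p y a b, frameNijenhuis
      (christoffel cov p) (frameJ₃ (chartEndo J p)) (extChartAt 𝓘(ℝ, E) p p) y a b = 0 := by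
  let B : Π p : M, TangentSpace 𝓘(ℝ, E) p × TangentSpace 𝓘(ℝ, E) p →ₗ[ℝ]
      TangentSpace 𝓘(ℝ, E) p × TangentSpace 𝓘(ℝ, E) p := fun q ↦ 
    ((J q : _ →ₗ[ℝ] _) ∘ₗ LinearMap.snd ℝ _ _).prod
      ((J q : _ →ₗ[ℝ] _) ∘ₗ LinearMap.fst ℝ _ _)
  have e : liftJ₃ cov J = fun u ↦ (liftEquiv cov u).conj (B u.proj) := rfl
  rw [e]
  refine isComplexStructure_conj_iff hcov (S := fun p ↦ frameJ₃ (chartEndo J p))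
    (fun p q hq v w ↦ ?_)
    (fun p ↦ differentiableAt_frameJ₃ (differentiableAt_chartEndo hJ p)) fun p a ↦ ?_
  · rw [frameJ₃_apply, chartEndo_chartCoord hq, chartEndo_chartCoord hq]
    rfl
  · simp only [frameJ₃_apply, chartEndo_sq hJ]
    rfl

variable {g : Π x : M, TangentSpace 𝓘(ℝ, E) x →L[ℝ] TangentSpace 𝓘(ℝ, E) x →L[ℝ] ℝ}

/-- The order matters: parallelism is obtained first, at every point and hence near each chart
centre, and only then can the curvature be shown to vanish. -/
theorem isComplexStructure_liftJ₁_iff_isFlat_and_isParallel (hJ : IsAlmostComplex J)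
    (hg : IsNordenMetric J g) (hcov : IsLeviCivita g cov) :
    IsComplexStructure 𝓘(ℝ, E).tangent (liftJ₁ cov J) ↔ IsFlat cov ∧ IsParallel cov J := by
  have hl := isLocalNorden hJ hg hcov
  rw [isComplexStructure_liftJ₁_iff hJ hcov.smooth, isFlat_iff hcov.smooth hcov.torsion_free]
  constructor
  · intro h
    have hp : IsParallel cov J :=
      isParallel_of_localCovJ hJ fun p ↦ (hl p).covJ_eq_zero_of_frameJ₁ (h p 0)
    exact ⟨fun p ↦ (hl p).curvature_eq_zero_of_frameJ₁ (hp.eventually_localCovJ hJ p) (h p), hp⟩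
  · rintro ⟨hR, hp⟩ p
    exact (hl p).frameNijenhuis_frameJ₁_eq_zero (hp.eventually_localCovJ hJ p).self_of_nhds (hR p)

theorem isComplexStructure_liftJ₂_iff_isFlat (hJ : IsAlmostComplex J)
    (hg : IsNordenMetric J g) (hcov : IsLeviCivita g cov) :
    IsComplexStructure 𝓘(ℝ, E).tangent (liftJ₂ cov) ↔ IsFlat cov := by
  have hl := isLocalNorden hJ hg hcov
  rw [isComplexStructure_liftJ₂_iff hcov.smooth, isFlat_iff hcov.smooth hcov.torsion_free]
  refine ⟨fun h p u v w ↦ ?_, fun hR p ↦ (hl p).frameNijenhuis_frameJ₂_eq_zero (hR p)⟩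
  have := (hl p).frameNijenhuis_frameJ₂_horizontal u v w
  rw [h] at this
  exact neg_eq_zero.1 (congrArg Prod.snd this).symm

/-- Unlike for $J_1$, flatness and parallelism follow independently of each other. -/
theorem isComplexStructure_liftJ₃_iff_isFlat_and_isParallel (hJ : IsAlmostComplex J)
    (hg : IsNordenMetric J g) (hcov : IsLeviCivita g cov) :
    IsComplexStructure 𝓘(ℝ, E).tangent (liftJ₃ cov J) ↔ IsFlat cov ∧ IsParallel cov J := by
  have hl := isLocalNorden hJ hg hcov
  rw [isComplexStructure_liftJ₃_iff hJ hcov.smooth, isFlat_iff hcov.smooth hcov.torsion_free]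
  constructor
  · intro h
    exact ⟨fun p ↦ (hl p).curvature_eq_zero_of_frameJ₃ (h p),
      isParallel_of_localCovJ hJ fun p ↦ (hl p).covJ_eq_zero_of_frameJ₃ (h p 0)⟩
  · rintro ⟨hR, hp⟩ p
    exact (hl p).frameNijenhuis_frameJ₃_eq_zero (hp.eventually_localCovJ hJ p).self_of_nhds (hR p)

end Lifted

end

theorem mainTheorem1
    {E : Type*} [NormedAddCommGroup E] [NormedSpace ℝ E] [FiniteDimensional ℝ E]
    {M : Type*} [TopologicalSpace M] [T2Space M] [SigmaCompactSpace M]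
    [ChartedSpace E M] [IsManifold 𝓘(ℝ, E) ∞ M]
    (J : Π x : M, TangentSpace 𝓘(ℝ, E) x →L[ℝ] TangentSpace 𝓘(ℝ, E) x)
    (hJ : IsAlmostComplex J)
    (g : Π x : M, TangentSpace 𝓘(ℝ, E) x →L[ℝ] TangentSpace 𝓘(ℝ, E) x →L[ℝ] ℝ)
    (hg : IsNordenMetric J g)
    (cov : CovariantDerivative 𝓘(ℝ, E) E (TangentSpace 𝓘(ℝ, E) : M → Type _))
    (hcov : IsLeviCivita g cov) :
    (IsComplexStructure 𝓘(ℝ, E).tangent (liftJ₁ cov J) ↔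
      IsComplexStructure 𝓘(ℝ, E).tangent (liftJ₃ cov J)) ∧
    (IsComplexStructure 𝓘(ℝ, E).tangent (liftJ₁ cov J) ↔ IsFlat cov ∧ IsParallel cov J) ∧
    (IsComplexStructure 𝓘(ℝ, E).tangent (liftJ₃ cov J) ↔ IsFlat cov ∧ IsParallel cov J) ∧
    (IsComplexStructure 𝓘(ℝ, E).tangent (liftJ₂ cov) ↔
      IsFlat cov) ∧
    (IsHypercomplexStructure 𝓘(ℝ, E).tangent (liftJ₁ cov J) (liftJ₂ cov) (liftJ₃ cov J) ↔
      IsFlat cov ∧ IsParallel cov J) := by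
  have h₁ := isComplexStructure_liftJ₁_iff_isFlat_and_isParallel hJ hg hcov
  have h₂ := isComplexStructure_liftJ₂_iff_isFlat hJ hg hcov
  have h₃ := isComplexStructure_liftJ₃_iff_isFlat_and_isParallel hJ hg hcov
  refine ⟨h₁.trans h₃.symm, h₁, h₃, h₂, ?_⟩
  rw [IsHypercomplexStructure, h₁, h₂, h₃]
  tauto
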